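/- Let $K$ be a field of characteristic zero, $G$ an abelian group with neutral element $e$, $\varepsilon:G\times G\to K^\times$ a bicharacter with $\varepsilon(g,h)\varepsilon(h,g)=1$, and $\mathfrak g=\bigoplus_{g\in G}\mathfrak g_g$ a $G$-graded $\varepsilon$-Lie algebra (color Lie algebra) over $K$, of arbitrary dimension. Its enveloping algebra $\mathcal U(\mathfrak g)$ is the quotient of the tensor algebra by the two-sided ideal generated by all $a\otimes b-\varepsilon(|a|,|b|)\,b\otimes a-[a,b]$ with $a,b$ homogeneous; it is $G$-graded. Let $H^2(\mathfrak g,K)_e$ be the degree-$e$ part of the second graded Chevalley–Eilenberg cohomology with coefficients in the trivial module $K$ (placed in degree $e$). A graded associative deformation of a $G$-graded associative algebra $A$ is a sequence $(\pi_n)_{n\ge 0}$ of bilinear maps $A\times A\to A$ with $\pi_n(A_g,A_h)\subseteq A_{gh}$, with $\pi_0$ the product of $A$, and such that $\pi_t=\sum_n t^n\pi_n$ is an associative product on $A[[t]]$. It is trivial if there are linear maps $\varphi_n:A\to A$ of degree $e$, with $\varphi_0=\mathrm{id}$, such that $\varphi_t=\sum_n t^n\varphi_n$ satisfies $\varphi_t(\pi_t(a,b))=\pi_0(\varphi_t(a),\varphi_t(b))$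 for all $a,b\in A[[t]]$. **Theorem.** Let $\omega\in Z^2(\mathfrak g,K)_e$ be a graded $2$-cocycle whose class in $H^2(\mathfrak g,K)_e$ is nonzero. Let $\mathfrak g_{t\omega}[[t]]=(\mathfrak g\otimes_K K[[t]])\oplus K[[t]]\,c$ be the color Lie algebra over $K[[t]]$ with $|c|=e$ and bracket $[X+\alpha c,Y+\beta c]=[X,Y]+t\,\omega(X,Y)\,c$, and let $\mathcal U_{t\omega}(\mathfrak g)$ be the quotient of its enveloping algebra over $K[[t]]$ by the two-sided ideal generated by $1-c$. Then: (1) There is an isomorphism of $G$-graded $K[[t]]$-modules $\Phi:\mathcal U(\mathfrak g)\otimes_K K[[t]]\to\mathcal U_{t\omega}(\mathfrak g)$, with $\Phi(1)=1$ and $\Phi(X)=X$ for all $X\in\mathfrak g$ (where $X$ also denotes its canonical image in each algebra), and a graded associative deformation $(\pi_n)$ of $\mathcal U(\mathfrak g)$ such that $\Phi^{-1}(\Phi(u)\Phi(v))=\sum_{n\ge0}t^n\pi_n(u,v)$ in $\mathcal U(\mathfrak g)[[t]]$ for all $u,v\in\mathcal U(\mathfrak g)$. (2) Every graded associative deformation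 of $\mathcal U(\mathfrak g)$ obtained in this way from some isomorphism $\Phi:\mathcal U(\mathfrak g)\otimes_K K[[t]]\to\mathcal U_{t\omega}(\mathfrak g)$ of $G$-graded $K[[t]]$-modules is nontrivial. In particular, if $H^2(\mathfrak g,K)_e\neq0$, then $\mathcal U(\mathfrak g)$ admits a nontrivial graded associative deformation. -/

import Mathlib

open scoped TensorProduct PowerSeries

noncomputable section

/-- An antisymmetric bicharacter on an abelian group `G` (written additively) with values in the
units of a commutative ring `R`. -/
structure Bicharacter (G R : Type*) [AddCommGroup G] [CommRing R] where
  toFun : G → G → Rˣ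
  antisymm : ∀ g h, toFun g h * toFun h g = 1
  add_right : ∀ g h k, toFun g (h + k) = toFun g h * toFun g k
  add_left : ∀ g h k, toFun (g + h) k = toFun g k * toFun h k

namespace Bicharacter

variable {G R : Type*} [AddCommGroup G] [CommRing R]

/-- The value of the bicharacter, as an element of `R`. -/
def val (ε : Bicharacter G R) (g h : G) : R := (ε.toFun g h : R)

/-- Extension of scalars of a bicharacter. -/
def map (S : Type*) [CommRing S] [Algebra R S] (ε : Bicharacter G R) : Bicharacter G S where
  toFun g h := Units.map (algebraMap R S).toMonoidHom (ε.toFun g h)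
  antisymm g h := by rw [← map_mul, ε.antisymm, map_one]
  add_right g h k := by rw [← map_mul, ε.add_right]
  add_left g h k := by rw [← map_mul, ε.add_left]

theorem map_val (S : Type*) [CommRing S] [Algebra R S] (ε : Bicharacter G R) (g h : G) :
    (ε.map S).val g h = algebraMap R S (ε.val g h) := rfl

theorem val_mul_val (ε : Bicharacter G R) (g h : G) : ε.val g h * ε.val h g = 1 := by
  simp only [val, ← Units.val_mul, ε.antisymm, Units.val_one]

theorem val_add_right (ε : Bicharacter G R) (g h k : G) :
    ε.val g (h + k) = ε.val g h * ε.val g k := by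
  simp only [val, ← Units.val_mul, ε.add_right]

theorem val_add_left (ε : Bicharacter G R) (g h k : G) :
    ε.val (g + h) k = ε.val g k * ε.val h k := by
  simp only [val, ← Units.val_mul, ε.add_left]

end Bicharacter

/-- A `G`-graded `ε`-Lie algebra (color Lie algebra) structure on the `R`-module `L`. -/
structure ColorLieAlgebra {G R : Type*} [AddCommGroup G] [DecidableEq G] [CommRing R]
    (ε : Bicharacter G R) (L : Type*) [AddCommGroup L] [Module R L] where
  grading : G → Submodule R L
  isInternal : DirectSum.IsInternal grading
  bracket : L →ₗ[R] L →ₗ[R] L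
  bracket_mem : ∀ {g h : G} {a b : L}, a ∈ grading g → b ∈ grading h →
    bracket a b ∈ grading (g + h)
  skew : ∀ {g h : G} {a b : L}, a ∈ grading g → b ∈ grading h →
    bracket a b = -(ε.val g h • bracket b a)
  jacobi : ∀ {g h k : G} {a b c : L}, a ∈ grading g → b ∈ grading h → c ∈ grading k →
    ε.val k g • bracket a (bracket b c) + ε.val g h • bracket b (bracket c a)
      + ε.val h k • bracket c (bracket a b) = 0

namespace ColorLieAlgebra

variable {G R L : Type*} [AddCommGroup G] [DecidableEq G] [CommRing R] {ε : Bicharacter G R}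
  [AddCommGroup L] [Module R L]

section Cohomology

variable (𝔤 : ColorLieAlgebra ε L)

/-- `C¹(𝔤, R)_e`: linear forms of degree zero, where `R` is concentrated in degree zero. -/
def C1 : Submodule R (L →ₗ[R] R) where
  carrier := {f | ∀ g x, x ∈ 𝔤.grading g → g ≠ 0 → f x = 0}
  add_mem' := by
    intro a b ha hb g x hx hg
    simp [ha g x hx hg, hb g x hx hg]
  zero_mem' := by intro g x _ _; rfl
  smul_mem' := by
    intro r a ha g x hx hg
    simp [ha g x hx hg]

/-- `C²(𝔤, R)_e`: `ε`-skew-symmetric bilinear forms of degree zero. -/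
def C2 : Submodule R (L →ₗ[R] L →ₗ[R] R) where
  carrier := {ω | (∀ g h x y, x ∈ 𝔤.grading g → y ∈ 𝔤.grading h → g + h ≠ 0 → ω x y = 0) ∧
    ∀ g h x y, x ∈ 𝔤.grading g → y ∈ 𝔤.grading h → ω x y = -(ε.val g h * ω y x)}
  add_mem' := by
    rintro a b ⟨ha, ha'⟩ ⟨hb, hb'⟩
    refine ⟨fun g h x y hx hy hgh => ?_, fun g h x y hx hy => ?_⟩
    · simp [ha g h x y hx hy hgh, hb g h x y hx hy hgh]
    · simp only [LinearMap.add_apply]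
      rw [ha' g h x y hx hy, hb' g h x y hx hy]; ring
  zero_mem' := by
    refine ⟨fun g h x y hx hy hgh => rfl, fun g h x y hx hy => ?_⟩
    simp
  smul_mem' := by
    rintro r a ⟨ha, ha'⟩
    refine ⟨fun g h x y hx hy hgh => ?_, fun g h x y hx hy => ?_⟩
    · simp [ha g h x y hx hy hgh]
    · simp only [LinearMap.smul_apply, smul_eq_mul]
      rw [ha' g h x y hx hy]; ring

/-- The Chevalley–Eilenberg coboundary (trivial coefficients) of a bilinear form of degree zero,
evaluated at homogeneous `x, y, z` of degrees `g, h, k`: the sum over `i < j` of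
`(-1)^(i+j) * sign * ω([x_i, x_j], x_l)`, where `sign` is the color sign of
moving `x_i, x_j` to the front. -/
def coboundary2 (ω : L →ₗ[R] L →ₗ[R] R) (g h k : G) (x y z : L) : R :=
  -ω (𝔤.bracket x y) z + ε.val h k * ω (𝔤.bracket x z) y
    - ε.val g h * ε.val g k * ω (𝔤.bracket y z) x

/-- `Z²(𝔤, R)_e`: graded 2-cocycles of degree zero. -/
def Z2 : Submodule R (L →ₗ[R] L →ₗ[R] R) where
  carrier := {ω | ω ∈ 𝔤.C2 ∧ ∀ g h k x y z, x ∈ 𝔤.grading g → y ∈ 𝔤.grading h →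
    z ∈ 𝔤.grading k → 𝔤.coboundary2 ω g h k x y z = 0}
  add_mem' := by
    rintro a b ⟨ha, ha'⟩ ⟨hb, hb'⟩
    refine ⟨add_mem ha hb, fun g h k x y z hx hy hz => ?_⟩
    have h1 := ha' g h k x y z hx hy hz
    have h2 := hb' g h k x y z hx hy hz
    simp only [coboundary2, LinearMap.add_apply] at h1 h2 ⊢
    linear_combination h1 + h2
  zero_mem' := by
    refine ⟨zero_mem _, fun g h k x y z hx hy hz => ?_⟩
    simp [coboundary2]
  smul_mem' := by
    rintro r a ⟨ha, ha'⟩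
    refine ⟨Submodule.smul_mem _ _ ha, fun g h k x y z hx hy hz => ?_⟩
    have h1 := ha' g h k x y z hx hy hz
    simp only [coboundary2, LinearMap.smul_apply, smul_eq_mul] at h1 ⊢
    linear_combination r * h1

/-- The cocycle condition in cyclic form. -/
theorem Z2_cyclic {ω : L →ₗ[R] L →ₗ[R] R} (hω : ω ∈ 𝔤.Z2) {g h k : G} {x y z : L}
    (hx : x ∈ 𝔤.grading g) (hy : y ∈ 𝔤.grading h) (hz : z ∈ 𝔤.grading k) :
    ε.val k g * ω x (𝔤.bracket y z) + ε.val g h * ω y (𝔤.bracket z x)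
      + ε.val h k * ω z (𝔤.bracket x y) = 0 := by
  obtain ⟨⟨-, hs⟩, hc⟩ := hω
  have h0 := hc g h k x y z hx hy hz
  have e1 := hs _ _ _ _ (𝔤.bracket_mem hx hy) hz
  have e2 := hs _ _ _ _ (𝔤.bracket_mem hz hx) hy
  have e3 := hs _ _ _ _ (𝔤.bracket_mem hy hz) hx
  have e4 := 𝔤.skew hx hz
  simp only [coboundary2] at h0
  rw [e4] at h0
  simp only [map_neg, map_smul, LinearMap.neg_apply, LinearMap.smul_apply, smul_eq_mul] at h0
  rw [e1, e2, e3] at h0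
  simp only [Bicharacter.val_add_left] at h0
  have q1 := ε.val_mul_val g h
  have q2 := ε.val_mul_val g k
  have q3 := ε.val_mul_val h k
  linear_combination (exp := 1) ε.val k g * h0
    - (ε.val g h * ω y (𝔤.bracket z x) * (ε.val h k * ε.val k h)
        + ε.val h k * ω z (𝔤.bracket x y)
        + ε.val k g * ω x (𝔤.bracket y z) * (ε.val g h * ε.val h g)) * q2
    - (ε.val k g * ω x (𝔤.bracket y z)) * q1
    - (ε.val g h * ω y (𝔤.bracket z x)) * q3

/-- The Chevalley–Eilenberg coboundary `(δf)(x, y) = -f([x, y])` on degree zero 1-cochains. -/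
def coboundary1 : 𝔤.C1 →ₗ[R] 𝔤.Z2 where
  toFun f := ⟨-(𝔤.bracket.compr₂ f.1), by
    obtain ⟨f, hf⟩ := f
    refine ⟨⟨fun g h x y hx hy hgh => ?_, fun g h x y hx hy => ?_⟩,
      fun g h k x y z hx hy hz => ?_⟩
    · simp [hf _ _ (𝔤.bracket_mem hx hy) hgh]
    · simp only [LinearMap.neg_apply, LinearMap.compr₂_apply]
      rw [𝔤.skew hx hy]; simp
    · have hj := congrArg f (𝔤.jacobi hx hy hz)
      have s1 := 𝔤.skew (𝔤.bracket_mem hx hy) hz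
      have s2 := 𝔤.skew (𝔤.bracket_mem hz hx) hy
      have s3 := 𝔤.skew (𝔤.bracket_mem hy hz) hx
      have s4 := 𝔤.skew hx hz
      simp only [coboundary2, LinearMap.neg_apply, LinearMap.compr₂_apply]
      rw [s4]
      simp only [map_neg, map_smul, LinearMap.neg_apply, LinearMap.smul_apply, smul_eq_mul]
      rw [s1, s2, s3]
      simp only [Bicharacter.val_add_left, map_neg, map_smul, smul_eq_mul, map_add,
        map_zero] at hj ⊢
      have q1 := ε.val_mul_val g h
      have q2 := ε.val_mul_val g k
      have q3 := ε.val_mul_val h k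
      linear_combination (-ε.val g k) * hj
        + (f (𝔤.bracket x (𝔤.bracket y z))) * q2
        - (ε.val g k * ε.val g h * f (𝔤.bracket y (𝔤.bracket z x))) * q3
        - (ε.val g k * ε.val k g * f (𝔤.bracket x (𝔤.bracket y z))) * q1
        - (f (𝔤.bracket x (𝔤.bracket y z))) * q2⟩
  map_add' f f' := by
    ext x y
    simp only [Submodule.coe_add, LinearMap.neg_apply, LinearMap.compr₂_apply,
      LinearMap.add_apply]
    ring
  map_smul' r f := by
    ext x y
    simp

instance : AddCommGroup 𝔤.Z2 := Module.addCommMonoidToAddCommGroup R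

/-- `H²(𝔤, R)_e`. -/
abbrev H2 : Type _ := 𝔤.Z2 ⧸ LinearMap.range 𝔤.coboundary1

/-- The class of a graded 2-cocycle in `H²(𝔤, R)_e`. -/
def cohomologyClass (ω : 𝔤.Z2) : 𝔤.H2 := (LinearMap.range 𝔤.coboundary1).mkQ ω

end Cohomology

section CentralExtension

/-- The grading of `L ⊕ R c` with `c` of degree zero. -/
def extGrading (𝓛 : G → Submodule R L) (g : G) : Submodule R (L × R) :=
  (𝓛 g).prod (if g = 0 then ⊤ else ⊥)

theorem extGrading_isInternal {𝓛 : G → Submodule R L} (h𝓛 : DirectSum.IsInternal 𝓛) :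
    DirectSum.IsInternal (extGrading 𝓛) := by
  let := h𝓛.chooseDecomposition
  have hi : ∀ g (x : 𝓛 g), ((x : L), (0 : R)) ∈ extGrading 𝓛 g := fun g x => ⟨x.2, zero_mem _⟩
  have hj : ∀ r : R, ((0 : L), r) ∈ extGrading 𝓛 0 := fun r => ⟨zero_mem _, by simp⟩
  let i : ∀ g, 𝓛 g →ₗ[R] extGrading 𝓛 g := fun g =>
    LinearMap.codRestrict _ (LinearMap.inl R L R ∘ₗ (𝓛 g).subtype) (hi g)
  let j : R →ₗ[R] extGrading 𝓛 0 := LinearMap.codRestrict _ (LinearMap.inr R L R) hj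
  let f : L × R →ₗ[R] DirectSum G (fun g => extGrading 𝓛 g) :=
    LinearMap.coprod (DirectSum.lmap i ∘ₗ (DirectSum.decomposeLinearEquiv 𝓛).toLinearMap)
      (DirectSum.lof R G (fun g => extGrading 𝓛 g) 0 ∘ₗ j)
  have hf1 : ∀ g (x : L) (hx : x ∈ 𝓛 g), f (x, 0) =
      DirectSum.lof R G (fun g => extGrading 𝓛 g) g ⟨(x, 0), hi g ⟨x, hx⟩⟩ := by
    intro g x hx
    have := DirectSum.decomposeLinearEquiv_apply_coe 𝓛 g ⟨x, hx⟩
    simp only [f, LinearMap.coprod_apply, LinearMap.comp_apply, map_zero, add_zero,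
      LinearEquiv.coe_coe]
    erw [this]
    rw [DirectSum.lmap_lof]
    rfl
  have hf2 : ∀ r : R, f (0, r) =
      DirectSum.lof R G (fun g => extGrading 𝓛 g) 0 ⟨(0, r), hj r⟩ := by
    intro r
    simp only [f, LinearMap.coprod_apply, LinearMap.comp_apply, map_zero, zero_add]
    rfl
  have := DirectSum.Decomposition.ofLinearMap (extGrading 𝓛) f ?_ ?_
  · exact DirectSum.Decomposition.isInternal _
  · refine LinearMap.prod_ext ?_ ?_
    · refine DirectSum.decompose_lhom_ext 𝓛 fun g => LinearMap.ext fun x => ?_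
      simp only [LinearMap.comp_apply, LinearMap.inl_apply, Submodule.subtype_apply]
      rw [hf1 g x x.2]
      simp
    · refine LinearMap.ext fun r => ?_
      simp only [LinearMap.comp_apply, LinearMap.inr_apply]
      rw [hf2]
      simp
  · refine DirectSum.linearMap_ext _ fun g => LinearMap.ext ?_
    rintro ⟨⟨x, r⟩, hx, hr⟩
    simp only [LinearMap.comp_apply, DirectSum.coeLinearMap_lof, LinearMap.id_apply]
    have e : f (x, r) = f (x, 0) + f (0, r) := by rw [← map_add]; simp
    rw [e, hf1 g x hx, hf2]
    by_cases hg : g = 0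
    · subst hg
      rw [← map_add]; simp
    · have : r = 0 := by simpa [hg] using hr
      subst this
      have z : (⟨(0, 0), hj 0⟩ : extGrading 𝓛 0) = 0 := rfl
      rw [z, map_zero, add_zero]

/-- The central extension `L ⊕ R c`, with `c = (0, 1)` of degree zero and
`[x + α c, y + β c] = [x, y] + ω(x, y) c`. -/
def centralExtension (𝔤 : ColorLieAlgebra ε L) (ω : 𝔤.Z2) : ColorLieAlgebra ε (L × R) where
  grading := extGrading 𝔤.grading
  isInternal := extGrading_isInternal 𝔤.isInternal
  bracket := LinearMap.mk₂ R (fun p q => (𝔤.bracket p.1 q.1, ω.1 p.1 q.1))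
    (fun _ _ _ => by simp) (fun _ _ _ => by simp) (fun _ _ _ => by simp) (fun _ _ _ => by simp)
  bracket_mem := by
    rintro g h ⟨a, r⟩ ⟨b, s⟩ ⟨ha, -⟩ ⟨hb, -⟩
    refine ⟨𝔤.bracket_mem ha hb, ?_⟩
    by_cases hgh : g + h = 0
    · simp [hgh]
    · simp [hgh, ω.2.1.1 g h a b ha hb hgh]
  skew := by
    rintro g h ⟨a, r⟩ ⟨b, s⟩ ⟨ha, -⟩ ⟨hb, -⟩
    exact Prod.ext (𝔤.skew ha hb) (ω.2.1.2 g h a b ha hb)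
  jacobi := by
    rintro g h k ⟨a, r⟩ ⟨b, s⟩ ⟨c, t⟩ ⟨ha, -⟩ ⟨hb, -⟩ ⟨hc, -⟩
    exact Prod.ext (𝔤.jacobi ha hb hc) (𝔤.Z2_cyclic ω.2 ha hb hc)

end CentralExtension

section BaseChange

theorem baseChange_induction {S : Type*} [CommRing S] [Algebra R S] {p : Submodule R L}
    {P : (x : S ⊗[R] L) → x ∈ p.baseChange S → Prop} (h0 : P 0 (zero_mem _))
    (hadd : ∀ x y hx hy, P x hx → P y hy → P (x + y) (add_mem hx hy))
    (ht : ∀ (s : S) (a : L) (ha : a ∈ p), P (s ⊗ₜ[R] a) (Submodule.tmul_mem_baseChange_of_mem s ha))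
    {x : S ⊗[R] L} (hx : x ∈ p.baseChange S) : P x hx := by
  have key : ∀ y : S ⊗[R] p, P (p.toBaseChange S y) (p.toBaseChange S y).2 := by
    intro y
    induction y with
    | zero => simpa using h0
    | add a b ha hb => simpa using hadd _ _ _ _ ha hb
    | tmul s a => exact ht s a a.2
  obtain ⟨y, hy⟩ := p.toBaseChange_surjective S ⟨x, hx⟩
  have := key y
  simpa only [hy] using this

variable (𝔤 : ColorLieAlgebra ε L) (S : Type*) [CommRing S] [Algebra R S]

/-- Extension of scalars `S ⊗ 𝔤`. -/
def baseChange : ColorLieAlgebra (ε.map S) (S ⊗[R] L) where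
  grading g := (𝔤.grading g).baseChange S
  isInternal := by
    let := 𝔤.isInternal.chooseDecomposition
    exact DirectSum.Decomposition.isInternal _
  bracket := LinearMap.BilinMap.baseChange S 𝔤.bracket
  bracket_mem := by
    intro g h a b ha hb
    induction ha using baseChange_induction with
    | h0 => simp
    | hadd x y _ _ hx hy => simpa using add_mem hx hy
    | ht s x hx =>
      induction hb using baseChange_induction with
      | h0 => simp
      | hadd x y _ _ hx hy => simpa using add_mem hx hy
      | ht t y hy =>
        rw [LinearMap.BilinMap.baseChange_tmul]
        exact Submodule.tmul_mem_baseChange_of_mem _ (𝔤.bracket_mem hx hy)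
  skew := by
    intro g h a b ha hb
    induction ha using baseChange_induction with
    | h0 => simp
    | hadd x y _ _ hx hy =>
      simp only [map_add, LinearMap.add_apply, smul_add, hx, hy]; abel
    | ht s x hx =>
      induction hb using baseChange_induction with
      | h0 => simp
      | hadd x y _ _ hx hy => simp only [map_add, LinearMap.add_apply, smul_add, hx, hy]; abel
      | ht t y hy =>
        simp only [LinearMap.BilinMap.baseChange_tmul]
        rw [𝔤.skew hx hy, Bicharacter.map_val, algebraMap_smul, TensorProduct.tmul_neg,
          TensorProduct.tmul_smul, mul_comm]
  jacobi := by
    intro g h k a b c ha hb hc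
    induction ha using baseChange_induction with
    | h0 => simp
    | hadd x y _ _ hx hy =>
      rw [← add_zero (0 : S ⊗[R] L)]
      nth_rw 1 [← hx]
      rw [← hy]
      simp only [map_add, LinearMap.add_apply, smul_add]; abel
    | ht s x hx =>
      induction hb using baseChange_induction with
      | h0 => simp
      | hadd x y _ _ hx hy =>
        rw [← add_zero (0 : S ⊗[R] L)]
        nth_rw 1 [← hx]
        rw [← hy]
        simp only [map_add, LinearMap.add_apply, smul_add]; abel
      | ht t y hy =>
        induction hc using baseChange_induction with
        | h0 => simp
        | hadd x y _ _ hx hy =>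
          rw [← add_zero (0 : S ⊗[R] L)]
          nth_rw 1 [← hx]
          rw [← hy]
          simp only [map_add, LinearMap.add_apply, smul_add]; abel
        | ht u z hz =>
          simp only [LinearMap.BilinMap.baseChange_tmul, Bicharacter.map_val, algebraMap_smul,
            ← TensorProduct.tmul_smul]
          rw [show t * (u * s) = s * (t * u) by ring, show u * (s * t) = s * (t * u) by ring,
            ← TensorProduct.tmul_add, ← TensorProduct.tmul_add, 𝔤.jacobi hx hy hz,
            TensorProduct.tmul_zero]

/-- Extension of scalars of a graded 2-cocycle. -/
def baseChangeCocycle (ω : 𝔤.Z2) : (𝔤.baseChange S).Z2 :=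
  ⟨LinearMap.BilinForm.baseChange S ω.1, by
    refine ⟨⟨fun g h a b ha hb hgh => ?_, fun g h a b ha hb => ?_⟩,
      fun g h k a b c ha hb hc => ?_⟩
    · induction ha using baseChange_induction with
      | h0 => simp
      | hadd x y _ _ hx hy => simp [hx, hy]
      | ht s x hx =>
        induction hb using baseChange_induction with
        | h0 => simp
        | hadd x y _ _ hx hy => simp [hx, hy]
        | ht t y hy => simp [ω.2.1.1 g h x y hx hy hgh]
    · induction ha using baseChange_induction with
      | h0 => simp
      | hadd x y _ _ hx hy =>
        simp only [map_add, LinearMap.add_apply, hx, hy]; ring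
      | ht s x hx =>
        induction hb using baseChange_induction with
        | h0 => simp
        | hadd x y _ _ hx hy => simp only [map_add, LinearMap.add_apply, hx, hy]; ring
        | ht t y hy =>
          simp only [LinearMap.BilinForm.baseChange_tmul]
          rw [ω.2.1.2 g h x y hx hy, Bicharacter.map_val]
          simp only [Algebra.smul_def, map_neg, map_mul]; ring
    · simp only [coboundary2]
      induction ha using baseChange_induction with
      | h0 => simp
      | hadd x y _ _ hx hy =>
        simp only [map_add, LinearMap.add_apply]
        linear_combination hx + hy
      | ht s x hx =>
        induction hb using baseChange_induction with
        | h0 => simp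
        | hadd x y _ _ hx hy =>
          simp only [map_add, LinearMap.add_apply]
          linear_combination hx + hy
        | ht t y hy =>
          induction hc using baseChange_induction with
          | h0 => simp
          | hadd x y _ _ hx hy =>
            simp only [map_add, LinearMap.add_apply]
            linear_combination hx + hy
          | ht u z hz =>
            have h0 := congrArg (algebraMap R S) (ω.2.2 g h k x y z hx hy hz)
            simp only [coboundary2, map_sub, map_add, map_mul, map_neg, map_zero] at h0
            simp only [baseChange, LinearMap.BilinMap.baseChange_tmul,
              LinearMap.BilinForm.baseChange_tmul, Bicharacter.map_val, Algebra.smul_def]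
            linear_combination (s * t * u) * h0⟩

end BaseChange

section Enveloping

variable (𝔤 : ColorLieAlgebra ε L)

/-- The two-sided ideal `J(L)` of the tensor algebra. -/
def envelopingIdeal : TwoSidedIdeal (TensorAlgebra R L) :=
  TwoSidedIdeal.span {u | ∃ (g h : G) (a b : L), a ∈ 𝔤.grading g ∧ b ∈ 𝔤.grading h ∧
    u = TensorAlgebra.ι R a * TensorAlgebra.ι R b
      - ε.val g h • (TensorAlgebra.ι R b * TensorAlgebra.ι R a)
      - TensorAlgebra.ι R (𝔤.bracket a b)}

/-- The universal enveloping algebra `U(𝔤) = T(L) / J(L)`. -/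
abbrev U : Type _ := 𝔤.envelopingIdeal.ringCon.Quotient

/-- The projection `T(L) → U(𝔤)`. -/
def mkU : TensorAlgebra R L →ₐ[R] 𝔤.U := RingCon.mkₐ R _

/-- The canonical map `𝔤 → U(𝔤)`. -/
def ι : L →ₗ[R] 𝔤.U := 𝔤.mkU.toLinearMap ∘ₗ TensorAlgebra.ι R

/-- Products `a₁ ⊗ ⋯ ⊗ aₙ` of homogeneous elements, with total degree `g`. -/
inductive IsHomogeneousTensor : G → TensorAlgebra R L → Prop
  | one : IsHomogeneousTensor 0 1
  | cons {g h : G} {a : L} {u : TensorAlgebra R L} (ha : a ∈ 𝔤.grading g)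
      (hu : IsHomogeneousTensor h u) : IsHomogeneousTensor (g + h) (TensorAlgebra.ι R a * u)

/-- The `G`-grading of `U(𝔤)` induced by the `G`-grading of the tensor algebra. -/
def gradingU (g : G) : Submodule R 𝔤.U :=
  (Submodule.span R {u | 𝔤.IsHomogeneousTensor g u}).map 𝔤.mkU.toLinearMap

theorem ι_mul_ι {g h : G} {a b : L} (ha : a ∈ 𝔤.grading g) (hb : b ∈ 𝔤.grading h) :
    𝔤.ι a * 𝔤.ι b - ε.val g h • (𝔤.ι b * 𝔤.ι a) = 𝔤.ι (𝔤.bracket a b) := by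
  have h1 := TwoSidedIdeal.subset_span (s := {u | ∃ (g h : G) (a b : L), a ∈ 𝔤.grading g ∧
    b ∈ 𝔤.grading h ∧ u = TensorAlgebra.ι R a * TensorAlgebra.ι R b
      - ε.val g h • (TensorAlgebra.ι R b * TensorAlgebra.ι R a)
      - TensorAlgebra.ι R (𝔤.bracket a b)}) ⟨g, h, a, b, ha, hb, rfl⟩
  have h2 : 𝔤.envelopingIdeal.ringCon (TensorAlgebra.ι R a * TensorAlgebra.ι R b
      - ε.val g h • (TensorAlgebra.ι R b * TensorAlgebra.ι R a))
      (TensorAlgebra.ι R (𝔤.bracket a b)) := (TwoSidedIdeal.rel_iff _ _ _).2 h1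
  exact Quotient.sound h2

theorem ι_mem {g : G} {a : L} (ha : a ∈ 𝔤.grading g) : 𝔤.ι a ∈ 𝔤.gradingU g := by
  refine ⟨TensorAlgebra.ι R a, Submodule.subset_span ?_, rfl⟩
  have := IsHomogeneousTensor.cons ha (IsHomogeneousTensor.one (𝔤 := 𝔤))
  rwa [add_zero, mul_one] at this

theorem IsHomogeneousTensor.mul {g h : G} {u v : TensorAlgebra R L}
    (hu : 𝔤.IsHomogeneousTensor g u) (hv : 𝔤.IsHomogeneousTensor h v) :
    𝔤.IsHomogeneousTensor (g + h) (u * v) := by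
  induction hu with
  | one => simpa using hv
  | cons ha _ ih => rw [add_assoc, mul_assoc]; exact .cons ha ih

instance gradingU_gradedMonoid : SetLike.GradedMonoid 𝔤.gradingU where
  one_mem := ⟨1, Submodule.subset_span .one, map_one 𝔤.mkU⟩
  mul_mem := by
    rintro g h _ _ ⟨u, hu, rfl⟩ ⟨v, hv, rfl⟩
    refine ⟨u * v, ?_, map_mul 𝔤.mkU u v⟩
    have := Submodule.mul_mem_mul hu hv
    rw [Submodule.span_mul_span] at this
    refine Submodule.span_mono ?_ this
    rintro _ ⟨x, hx, y, hy, rfl⟩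
    exact hx.mul 𝔤 hy

/-- The grading of `U(𝔤)` is a grading: the decomposition map. -/
theorem exists_decomposition : ∃ F : 𝔤.U →ₐ[R] DirectSum G (fun g => 𝔤.gradingU g),
    ∀ (g : G) (a : L) (ha : a ∈ 𝔤.grading g),
      F (𝔤.ι a) = DirectSum.of (fun g => 𝔤.gradingU g) g ⟨𝔤.ι a, 𝔤.ι_mem ha⟩ := by
  let := 𝔤.isInternal.chooseDecomposition
  let i : ∀ g, 𝔤.grading g →ₗ[R] 𝔤.gradingU g := fun g =>
    LinearMap.codRestrict _ (𝔤.ι ∘ₗ (𝔤.grading g).subtype) (fun x => 𝔤.ι_mem x.2)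
  let f : L →ₗ[R] DirectSum G (fun g => 𝔤.gradingU g) :=
    DirectSum.lmap i ∘ₗ (DirectSum.decomposeLinearEquiv 𝔤.grading).toLinearMap
  have hf : ∀ (g : G) (a : L) (ha : a ∈ 𝔤.grading g),
      f a = DirectSum.of (fun g => 𝔤.gradingU g) g ⟨𝔤.ι a, 𝔤.ι_mem ha⟩ := by
    intro g a ha
    have := DirectSum.decomposeLinearEquiv_apply_coe 𝔤.grading g ⟨a, ha⟩
    simp only [f, LinearMap.comp_apply, LinearEquiv.coe_coe]
    erw [this]
    rw [DirectSum.lmap_lof]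
    rfl
  have hker : 𝔤.envelopingIdeal.ringCon ≤ RingCon.ker (TensorAlgebra.lift R f).toRingHom := by
    have : 𝔤.envelopingIdeal ≤ TwoSidedIdeal.ker (TensorAlgebra.lift R f).toRingHom := by
      refine TwoSidedIdeal.span_le.2 ?_
      rintro _ ⟨g, h, a, b, ha, hb, rfl⟩
      refine (TwoSidedIdeal.mem_ker _).2 ?_
      have e1 := hf g a ha
      have e2 := hf h b hb
      have e3 := hf _ _ (𝔤.bracket_mem ha hb)
      have e4 := 𝔤.ι_mul_ι ha hb
      simp only [AlgHom.toRingHom_eq_coe, RingHom.coe_coe, map_sub, map_mul, map_smul,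
        TensorAlgebra.lift_ι_apply]
      have hc : ∀ (p q : G) (z : 𝔤.U) (hz : z ∈ 𝔤.gradingU p) (hz' : z ∈ 𝔤.gradingU q),
          p = q → DirectSum.of (fun g => 𝔤.gradingU g) p ⟨z, hz⟩ =
            DirectSum.of (fun g => 𝔤.gradingU g) q ⟨z, hz'⟩ := by
        rintro p q z hz hz' rfl; rfl
      have hba : 𝔤.ι b * 𝔤.ι a ∈ 𝔤.gradingU (g + h) := by
        rw [add_comm]; exact SetLike.mul_mem_graded (𝔤.ι_mem hb) (𝔤.ι_mem ha)
      have e5 : DirectSum.of (fun g => 𝔤.gradingU g) h ⟨𝔤.ι b, 𝔤.ι_mem hb⟩ *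
          DirectSum.of (fun g => 𝔤.gradingU g) g ⟨𝔤.ι a, 𝔤.ι_mem ha⟩ =
          DirectSum.of (fun g => 𝔤.gradingU g) (g + h) ⟨𝔤.ι b * 𝔤.ι a, hba⟩ := by
        rw [DirectSum.of_mul_of]
        exact hc _ _ _ _ hba (add_comm h g)
      rw [e1, e2, e3, e5, DirectSum.of_mul_of, ← DirectSum.lof_eq_of R,
        ← DirectSum.lof_eq_of R, ← DirectSum.lof_eq_of R, ← map_smul, ← map_sub, ← map_sub]
      refine (congrArg _ (Subtype.ext ?_)).trans (map_zero _)
      exact sub_eq_zero.2 e4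
    intro x y hxy
    have h1 := this ((TwoSidedIdeal.rel_iff _ _ _).1 hxy)
    have h2 := (TwoSidedIdeal.mem_ker _).1 h1
    rw [map_sub, sub_eq_zero] at h2
    exact h2
  refine ⟨RingCon.liftₐ _ (TensorAlgebra.lift R f) hker, fun g a ha => ?_⟩
  rw [← hf g a ha]
  exact TensorAlgebra.lift_ι_apply f a

theorem exists_gradedAlgebra : Nonempty (GradedAlgebra 𝔤.gradingU) := by
  obtain ⟨F, hF⟩ := 𝔤.exists_decomposition
  let := 𝔤.isInternal.chooseDecomposition
  have hT : ∀ (g : G) (u : TensorAlgebra R L) (_ : 𝔤.IsHomogeneousTensor g u)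
      (z : 𝔤.U) (hz : z ∈ 𝔤.gradingU g), z = 𝔤.mkU u →
      F z = DirectSum.of (fun g => 𝔤.gradingU g) g ⟨z, hz⟩ := by
    intro g u hu
    induction hu with
    | one =>
      intro z hz e
      rw [map_one] at e
      subst e
      rw [map_one]
      rfl
    | @cons g h a u ha hu ih =>
      intro z hz e
      have h1 : 𝔤.mkU u ∈ 𝔤.gradingU h := ⟨u, Submodule.subset_span hu, rfl⟩
      rw [map_mul] at e
      subst e
      rw [map_mul, ih _ h1 rfl]
      have := hF g a ha
      simp only [ι, LinearMap.comp_apply, AlgHom.toLinearMap_apply] at this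
      rw [this, DirectSum.of_mul_of]
      rfl
  refine ⟨GradedAlgebra.ofAlgHom _ F ?_ ?_⟩
  · have hs : Function.Surjective 𝔤.mkU := RingCon.mkₐ_surjective _
    have : ((DirectSum.coeAlgHom 𝔤.gradingU).comp F).comp 𝔤.mkU = 𝔤.mkU := by
      refine TensorAlgebra.hom_ext (DirectSum.decompose_lhom_ext 𝔤.grading fun g =>
        LinearMap.ext fun a => ?_)
      have := hF g a a.2
      simp only [ι, LinearMap.comp_apply, AlgHom.toLinearMap_apply] at this
      simp only [LinearMap.comp_apply, AlgHom.toLinearMap_apply, AlgHom.comp_apply,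
        Submodule.subtype_apply]
      rw [this]
      exact DirectSum.coeAlgHom_of _ _ _
    refine AlgHom.ext fun x => ?_
    obtain ⟨u, rfl⟩ := hs x
    exact AlgHom.congr_fun this u
  · rintro g ⟨z, u, hu, e⟩
    have hu0 : ∀ u ∈ Submodule.span R {u | 𝔤.IsHomogeneousTensor g u},
        ∀ (z : 𝔤.U) (hz : z ∈ 𝔤.gradingU g), z = 𝔤.mkU u →
          F z = DirectSum.lof R G (fun g => 𝔤.gradingU g) g ⟨z, hz⟩ := by
      intro u hu
      induction hu using Submodule.span_induction with
      | mem u hu => exact hT g u hu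
      | zero =>
        intro z hz e
        rw [map_zero] at e
        subst e
        rw [map_zero]
        exact (map_zero (DirectSum.lof R G (fun g => 𝔤.gradingU g) g)).symm
      | add u v hu hv ihu ihv =>
        intro z hz e
        rw [map_add] at e
        subst e
        rw [map_add, ihu (𝔤.mkU u) ⟨u, hu, rfl⟩ rfl, ihv (𝔤.mkU v) ⟨v, hv, rfl⟩ rfl, ← map_add]
        rfl
      | smul r u hu ih =>
        intro z hz e
        rw [map_smul] at e
        subst e
        rw [map_smul, ih (𝔤.mkU u) ⟨u, hu, rfl⟩ rfl, ← map_smul]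
        rfl
    exact hu0 u hu z _ e.symm

instance gradedAlgebraU : GradedAlgebra 𝔤.gradingU := 𝔤.exists_gradedAlgebra.some

end Enveloping
end ColorLieAlgebra

section Deformation

variable {G K A : Type*} [AddCommGroup G] [DecidableEq G] [Field K] [Ring A] [Algebra K A]

/-- The `K[[t]]`-bilinear product on `A[[t]]` given by a sequence of bilinear maps:
`(∑ tˢ aₛ) ⋆ (∑ tˢ' bₛ') = ∑ₙ tⁿ ∑_{r + s + s' = n} πᵣ(aₛ, bₛ')`. -/
def starProduct (π : ℕ → A →ₗ[K] A →ₗ[K] A) (a b : A⟦X⟧) : A⟦X⟧ :=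
  PowerSeries.mk fun n => ∑ p ∈ Finset.HasAntidiagonal.antidiagonal n, ∑ q ∈ Finset.HasAntidiagonal.antidiagonal p.2,
    π p.1 (PowerSeries.coeff q.1 a) (PowerSeries.coeff q.2 b)

/-- The `K[[t]]`-linear endomorphism `∑ tⁿ φₙ` of `A[[t]]`. -/
def formalMap (φ : ℕ → A →ₗ[K] A) (a : A⟦X⟧) : A⟦X⟧ :=
  PowerSeries.mk fun n => ∑ p ∈ Finset.HasAntidiagonal.antidiagonal n, φ p.1 (PowerSeries.coeff p.2 a)

/-- A graded associative deformation of the `G`-graded associative algebra `A = ⨁ 𝒜 g`: an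
associative product `∑ tⁿ πₙ` on `A[[t]]` with all `πₙ` of degree zero and `π₀` the product
of `A`. -/
structure GradedDeformation (𝒜 : G → Submodule K A) [GradedAlgebra 𝒜] where
  π : ℕ → A →ₗ[K] A →ₗ[K] A
  π_zero : π 0 = LinearMap.mul K A
  degree : ∀ (n : ℕ) {g h : G} {u v : A}, u ∈ 𝒜 g → v ∈ 𝒜 h → π n u v ∈ 𝒜 (g + h)
  assoc : ∀ a b c : A⟦X⟧,
    starProduct π (starProduct π a b) c = starProduct π a (starProduct π b c)

namespace GradedDeformation

variable {𝒜 : G → Submodule K A} [GradedAlgebra 𝒜]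

/-- Equivalence of graded deformations: a formal isomorphism `id + t φ₁ + t² φ₂ + ⋯` with all
`φₙ` of degree zero. -/
def Equivalent (D D' : GradedDeformation 𝒜) : Prop :=
  ∃ φ : ℕ → A →ₗ[K] A, φ 0 = LinearMap.id ∧
    (∀ (n : ℕ) (g : G) (u : A), u ∈ 𝒜 g → φ n u ∈ 𝒜 g) ∧
    ∀ a b : A⟦X⟧, formalMap φ (starProduct D.π a b) =
      starProduct D'.π (formalMap φ a) (formalMap φ b)

theorem starProduct_undeformed (a b : A⟦X⟧) :
    starProduct (fun n => if n = 0 then LinearMap.mul K A else 0) a b = a * b := by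
  ext n
  rw [starProduct, PowerSeries.coeff_mk, PowerSeries.coeff_mul,
    Finset.sum_eq_single_of_mem (0, n) (by simp)]
  · simp
  · rintro ⟨i, j⟩ hij hne
    have : i ≠ 0 := by
      rintro rfl
      simp_all
    simp [this]

variable (𝒜) in
/-- The undeformed product of `A`, extended to `A[[t]]`. -/
def undeformed : GradedDeformation 𝒜 where
  π n := if n = 0 then LinearMap.mul K A else 0
  π_zero := by simp
  degree := by
    intro n g h u v hu hv
    by_cases hn : n = 0
    · simpa [hn] using SetLike.mul_mem_graded hu hv
    · simp [hn]
  assoc a b c := by simp only [starProduct_undeformed, mul_assoc]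

/-- A graded deformation is trivial if it is equivalent to the undeformed product. -/
def IsTrivial (D : GradedDeformation 𝒜) : Prop := D.Equivalent (undeformed 𝒜)

end GradedDeformation

/-- The canonical map `K[[t]] ⊗ A → A[[t]]`. -/
def tensorToSeries (x : K⟦X⟧ ⊗[K] A) : A⟦X⟧ :=
  PowerSeries.mk fun n =>
    TensorProduct.lift (LinearMap.lsmul K A ∘ₗ (PowerSeries.coeff n : K⟦X⟧ →ₗ[K] K)) x

end Deformation

namespace ColorLieAlgebra

variable {G K L : Type*} [AddCommGroup G] [DecidableEq G] [Field K] {ε : Bicharacter G K}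
  [AddCommGroup L] [Module K L] (𝔤 : ColorLieAlgebra ε L)

/-- The central extension `𝔤_{tω}[[t]] = (K[[t]] ⊗ 𝔤) ⊕ K[[t]] c` over `K[[t]]`. -/
def formalExtension (ω : 𝔤.Z2) : ColorLieAlgebra (ε.map K⟦X⟧) ((K⟦X⟧ ⊗[K] L) × K⟦X⟧) :=
  (𝔤.baseChange K⟦X⟧).centralExtension ((PowerSeries.X : K⟦X⟧) • 𝔤.baseChangeCocycle K⟦X⟧ ω)

/-- The two-sided ideal of `U(𝔤_{tω}[[t]])` generated by `1 - c`. -/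
def centralIdeal (ω : 𝔤.Z2) : TwoSidedIdeal (𝔤.formalExtension ω).U :=
  TwoSidedIdeal.span {1 - (𝔤.formalExtension ω).ι (0, 1)}

/-- The `K[[t]]`-algebra `U_{tω}(𝔤) = U(𝔤_{tω}[[t]]) / (1 - c)`. -/
abbrev UT (ω : 𝔤.Z2) : Type _ := (𝔤.centralIdeal ω).ringCon.Quotient

/-- The projection `U(𝔤_{tω}[[t]]) → U_{tω}(𝔤)`. -/
def mkUT (ω : 𝔤.Z2) : (𝔤.formalExtension ω).U →ₐ[K⟦X⟧] 𝔤.UT ω := RingCon.mkₐ K⟦X⟧ _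

/-- The `G`-grading of `U_{tω}(𝔤)`. -/
def gradingUT (ω : 𝔤.Z2) (g : G) : Submodule K⟦X⟧ (𝔤.UT ω) :=
  ((𝔤.formalExtension ω).gradingU g).map (𝔤.mkUT ω).toLinearMap

/-- The canonical map `𝔤 → U_{tω}(𝔤)`. -/
def ιUT (ω : 𝔤.Z2) (x : L) : 𝔤.UT ω := 𝔤.mkUT ω ((𝔤.formalExtension ω).ι (1 ⊗ₜ[K] x, 0))

/-- The isomorphism of `K[[t]]`-modules `Φ` respects the `G`-gradings. -/
def IsGradedEquiv {ω : 𝔤.Z2} (Φ : (K⟦X⟧ ⊗[K] 𝔤.U) ≃ₗ[K⟦X⟧] 𝔤.UT ω) : Prop :=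
  ∀ g, ((𝔤.gradingU g).baseChange K⟦X⟧).map Φ.toLinearMap = 𝔤.gradingUT ω g

/-- The product of `U_{tω}(𝔤)`, transported along `Φ` and restricted to `U(𝔤)`, is
`∑ tⁿ πₙ`. -/
def IsInducedBy {ω : 𝔤.Z2} (D : GradedDeformation 𝔤.gradingU)
    (Φ : (K⟦X⟧ ⊗[K] 𝔤.U) ≃ₗ[K⟦X⟧] 𝔤.UT ω) : Prop :=
  ∀ u v : 𝔤.U, tensorToSeries (Φ.symm (Φ (1 ⊗ₜ[K] u) * Φ (1 ⊗ₜ[K] v))) =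
    PowerSeries.mk fun n => D.π n u v

end ColorLieAlgebra

end

/-! Setting `c = 1` presents `UT` over `K⟦X⟧` by the relations xy - ε(g,h)yx = [x,y] + tω(x,y). Both
`U` and `UT` are thus instances of one construction: the quotient of a tensor algebra by the
relators of a color Lie algebra with a 2-cocycle, the cocycle being 0 over K in the first case and
tω over `K⟦X⟧` in the second.

For this construction a Poincaré–Birkhoff–Witt theorem holds over any commutative ℚ-algebra, given a
homogeneous basis with signs ε(g,g) = ±1. The proof is Bergman's diamond lemma. The relations become
rewriting rules on words in the basis: sort decreasing pairs, and replace the square of an odd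
letter by half its bracket plus cocycle value. The overlaps resolve by the Jacobi identity and the
cocycle condition (`overlap_eq`, `isConfluent`), so the normal words give a basis (`pbwBasis`). The
set of normal words depends only on the letters, their order and their parity, so `U` and `UT` have
bases indexed by the same set. Matching them gives Φ, and specialization at t = 0 shows that the
transported product starts with the product of `U`.

For nontriviality, a trivialization φ_t of any induced deformation makes z ↦ φ_t(Φ⁻¹(z)) a ring
homomorphism from `UT` to U[[t]]. Its t-coefficient p₁ is a derivation along its constant
coefficient p₀. Apply p₁ to the defining relation and then a character e of `U` that, composed with
p₀, kills the image of 𝔤: the products vanish, leaving 0 = f([x,y]) + ω(x,y) with f = e ∘ p₁ on 𝔤.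
Hence ω = δf (`cohomologyClass_eq_zero_of_isTrivial`). -/

noncomputable section

/-! ### A well-founded order on words. -/

namespace List

variable {I : Type*} [LinearOrder I]

/-- The number of inversions of a word. -/
def inversions : List I → ℕ
  | [] => 0
  | a :: l => l.countP (· < a) + inversions l

/-- Letters left of the pair see the same multiset to their right, so only the inversion of the pair
itself is lost. -/
theorem inversions_swap_lt (u v : List I) {i j : I} (h : j < i) :
    inversions (u ++ j :: i :: v) < inversions (u ++ i :: j :: v) := by
  induction u with
  | nil => simp [inversions, h, h.le]; omega
  | cons a u ih =>
    have : (u ++ j :: i :: v).Perm (u ++ i :: j :: v) :=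
      List.Perm.append_left _ (List.Perm.swap _ _ _)
    simp only [List.cons_append, inversions, this.countP_eq]
    omega

/-- The order on words for which the rewriting rules of an enveloping algebra are decreasing. -/
def Smaller (w w' : List I) : Prop :=
  Prod.Lex (· < ·) (· < ·) (w.length, w.inversions) (w'.length, w'.inversions)

theorem smaller_wf : WellFounded (Smaller (I := I)) :=
  InvImage.wf (fun w : List I => (w.length, w.inversions))
    (WellFounded.prod_lex wellFounded_lt wellFounded_lt)

theorem Smaller.trans {u v w : List I} (h : Smaller u v) (h' : Smaller v w) : Smaller u w := by
  simp only [Smaller, Prod.lex_def] at *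
  omega

theorem Smaller.of_length_lt {w w' : List I} (h : w.length < w'.length) : Smaller w w' :=
  Prod.Lex.left _ _ h

theorem Smaller.swap (u v : List I) {i j : I} (h : j < i) :
    Smaller (u ++ j :: i :: v) (u ++ i :: j :: v) := by
  refine Prod.lex_def.2 (Or.inr ⟨by simp, inversions_swap_lt u v h⟩)

end List

/-! ### Color signs, relators and the overlap identity. -/

namespace Bicharacter

variable {G R : Type*} [AddCommGroup G] [CommRing R] (ε : Bicharacter G R)

/-- Bilinearity makes the value idempotent, and it is a unit. -/
theorem val_zero_right (g : G) : ε.val g 0 = 1 := by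
  have h1 := ε.val_add_right g 0 0
  have h2 := ε.val_mul_val g 0
  rw [add_zero] at h1
  linear_combination (1 - ε.val g 0) * h2 - ε.val 0 g * h1

theorem val_zero_left (g : G) : ε.val 0 g = 1 := by
  have h := ε.val_mul_val g 0
  rwa [ε.val_zero_right, one_mul] at h

end Bicharacter

namespace ColorLieAlgebra

section Cancel

variable {R M : Type*} [CommRing R] [Algebra ℚ R] [AddCommGroup M] [Module R M] {x y : M}

theorem eq_of_two_smul_eq (h : (2 : R) • x = (2 : R) • y) : x = y := by
  have := congrArg (fun t => algebraMap ℚ R (1 / 2) • t) h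
  simp only [smul_smul] at this
  rwa [← map_ofNat (algebraMap ℚ R) 2, ← map_mul, one_div_mul_cancel two_ne_zero, map_one,
    one_smul, one_smul] at this

theorem eq_of_three_smul_eq (h : (3 : R) • x = (3 : R) • y) : x = y := by
  have := congrArg (fun t => algebraMap ℚ R (1 / 3) • t) h
  simp only [smul_smul] at this
  rwa [← map_ofNat (algebraMap ℚ R) 3, ← map_mul, one_div_mul_cancel three_ne_zero, map_one,
    one_smul, one_smul] at this

end Cancel

variable {G R L : Type*} [AddCommGroup G] [DecidableEq G] [CommRing R] {ε : Bicharacter G R}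
  [AddCommGroup L] [Module R L]

/-- A homogeneous basis of a color Lie algebra, with a parity for each basis vector. -/
structure HomogeneousBasis (𝔤 : ColorLieAlgebra ε L) (I : Type*) where
  basis : Module.Basis I R L
  deg : I → G
  odd : I → Prop
  mem_grading : ∀ i, basis i ∈ 𝔤.grading (deg i)
  grading_le : ∀ g, 𝔤.grading g ≤ Submodule.span R (basis '' {i | deg i = g})
  val_of_odd : ∀ i, odd i → ε.val (deg i) (deg i) = -1
  val_of_not_odd : ∀ i, ¬ odd i → ε.val (deg i) (deg i) = 1

section Relations

variable (𝔤 : ColorLieAlgebra ε L) (ω : 𝔤.Z2)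

/-- The part `[x, y] + ω(x, y)` of tensor degree at most one in the defining relation. -/
def lowerPart (x y : L) : TensorAlgebra R L :=
  TensorAlgebra.ι R (𝔤.bracket x y) + algebraMap R _ (ω.1 x y)

/-- The defining relation `x y - ε(g, h) y x - [x, y] - ω(x, y)` for `x, y` of degrees `g, h`. -/
def relator (g h : G) (x y : L) : TensorAlgebra R L :=
  TensorAlgebra.ι R x * TensorAlgebra.ι R y
    - ε.val g h • (TensorAlgebra.ι R y * TensorAlgebra.ι R x) - 𝔤.lowerPart ω x y

variable {𝔤}

theorem lowerPart_skew {g h : G} {x y : L} (hx : x ∈ 𝔤.grading g) (hy : y ∈ 𝔤.grading h) :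
    𝔤.lowerPart ω x y = -(ε.val g h • 𝔤.lowerPart ω y x) := by
  simp only [lowerPart]
  rw [𝔤.skew hx hy, ω.2.1.2 g h x y hx hy]
  simp only [map_neg, map_smul, map_mul, Algebra.smul_def, mul_add]
  abel

theorem relator_skew {g h : G} {x y : L} (hx : x ∈ 𝔤.grading g) (hy : y ∈ 𝔤.grading h) :
    𝔤.relator ω g h x y = -(ε.val g h • 𝔤.relator ω h g y x) := by
  simp only [relator]
  rw [lowerPart_skew ω hx hy, smul_sub, smul_sub, smul_smul, ε.val_mul_val, one_smul]
  abel

/-- Skew-symmetry says that twice the lower part is zero. So the relator of an even basis vector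
with itself is trivial, and even squares need no rewriting rule. -/
theorem lowerPart_self [Algebra ℚ R] {g : G} {x : L} (hx : x ∈ 𝔤.grading g)
    (hg : ε.val g g = 1) : 𝔤.lowerPart ω x x = 0 := by
  have h := lowerPart_skew ω hx hx
  rw [hg, one_smul, eq_neg_iff_add_eq_zero, ← two_smul R] at h
  exact eq_of_two_smul_eq (R := R) (h.trans (smul_zero _).symm)

/-- The bracket part is the color Jacobi identity and the constant part is the cyclic cocycle
identity, each solved for its first term. This is where the cocycle condition enters the rewriting
argument. -/
theorem lowerPart_jacobi {g h k : G} {x y z : L} (hx : x ∈ 𝔤.grading g) (hy : y ∈ 𝔤.grading h)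
    (hz : z ∈ 𝔤.grading k) :
    𝔤.lowerPart ω x (𝔤.bracket y z) = ε.val g h • 𝔤.lowerPart ω y (𝔤.bracket x z)
      - (ε.val h k * ε.val g k) • 𝔤.lowerPart ω z (𝔤.bracket x y) := by
  have j := 𝔤.jacobi hx hy hz
  have c := 𝔤.Z2_cyclic ω.2 hx hy hz
  rw [𝔤.skew hz hx] at j c
  simp only [map_neg, map_smul, smul_eq_mul] at j c
  have q := ε.val_mul_val g k
  have e1 : 𝔤.bracket x (𝔤.bracket y z) = ε.val g h • 𝔤.bracket y (𝔤.bracket x z)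
      - (ε.val h k * ε.val g k) • 𝔤.bracket z (𝔤.bracket x y) := by
    linear_combination (norm := module) ε.val g k • j - q • 𝔤.bracket x (𝔤.bracket y z)
      + q • (ε.val g h • 𝔤.bracket y (𝔤.bracket x z))
  have e2 : ω.1 x (𝔤.bracket y z) = ε.val g h * ω.1 y (𝔤.bracket x z)
      - (ε.val h k * ε.val g k) * ω.1 z (𝔤.bracket x y) := by
    linear_combination ε.val g k * c - q * ω.1 x (𝔤.bracket y z)
      + q * (ε.val g h * ω.1 y (𝔤.bracket x z))
  simp only [lowerPart]
  rw [e1, e2]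
  simp only [map_sub, map_smul, map_mul, Algebra.smul_def, mul_add]
  abel

/-- The constant ω(y,z) drops out of the color commutator: if it is nonzero then h + k = 0, so the
sign ε(g,h)ε(g,k) = ε(g,h+k) is 1. -/
theorem smul_lowerPart_mul {g h k : G} {x y z : L} (hy : y ∈ 𝔤.grading h)
    (hz : z ∈ 𝔤.grading k) :
    TensorAlgebra.ι R x * 𝔤.lowerPart ω y z
        - (ε.val g h * ε.val g k) • (𝔤.lowerPart ω y z * TensorAlgebra.ι R x) =
      𝔤.relator ω g (h + k) x (𝔤.bracket y z) + 𝔤.lowerPart ω x (𝔤.bracket y z) := by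
  have : (ε.val g h * ε.val g k) * ω.1 y z = ω.1 y z := by
    by_cases hk : h + k = 0
    · rw [← ε.val_add_right, hk, ε.val_zero_right, one_mul]
    · rw [ω.2.1.1 h k y z hy hz hk, mul_zero]
  simp only [relator, lowerPart, mul_add, add_mul, smul_add, ε.val_add_right]
  rw [← Algebra.commutes (ω.1 y z) (TensorAlgebra.ι R x)]
  nth_rw 1 [← this]
  simp only [Algebra.smul_def, map_mul, mul_assoc]
  abel

/-- The obstruction to resolving the overlap `x y z` vanishes modulo the defining relations. -/
theorem overlap_eq {g h k : G} {x y z : L} (hx : x ∈ 𝔤.grading g) (hy : y ∈ 𝔤.grading h)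
    (hz : z ∈ 𝔤.grading k) :
    (ε.val g h * ε.val g k) • (𝔤.lowerPart ω y z * TensorAlgebra.ι R x)
      - TensorAlgebra.ι R x * 𝔤.lowerPart ω y z
      + ε.val g h • (TensorAlgebra.ι R y * 𝔤.lowerPart ω x z)
      - ε.val h k • (𝔤.lowerPart ω x z * TensorAlgebra.ι R y)
      + 𝔤.lowerPart ω x y * TensorAlgebra.ι R z
      - (ε.val h k * ε.val g k) • (TensorAlgebra.ι R z * 𝔤.lowerPart ω x y) =
    -𝔤.relator ω g (h + k) x (𝔤.bracket y z)
      + ε.val g h • 𝔤.relator ω h (g + k) y (𝔤.bracket x z)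
      - (ε.val h k * ε.val g k) • 𝔤.relator ω k (g + h) z (𝔤.bracket x y) := by
  -- The left-hand side groups into three color commutators of a letter with a lower part. Each
  -- becomes a relator plus the lower part of an iterated bracket, and these last terms cancel by
  -- `j`.
  have h1 := smul_lowerPart_mul ω (g := g) (x := x) hy hz
  have h2 := smul_lowerPart_mul ω (g := h) (x := y) hx hz
  have h3 := smul_lowerPart_mul ω (g := k) (x := z) hx hy
  have j := lowerPart_jacobi ω hx hy hz
  have q1 := ε.val_mul_val g h
  have q2 := ε.val_mul_val g k
  have q3 := ε.val_mul_val h k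
  have q4 : ε.val h k * ε.val g k * (ε.val k g * ε.val k h) = 1 := by
    linear_combination q2 + ε.val g k * ε.val k g * q3
  linear_combination (norm := module) -h1 + ε.val g h • h2 - (ε.val h k * ε.val g k) • h3
    + q1 • (ε.val h k • (𝔤.lowerPart ω x z * TensorAlgebra.ι R y))
    - q4 • (𝔤.lowerPart ω x y * TensorAlgebra.ι R z) - j

end Relations

end ColorLieAlgebra

/-! ### Words in a homogeneous basis, rewriting rules and normal forms. -/

namespace ColorLieAlgebra

variable {G R L : Type*} [AddCommGroup G] [DecidableEq G] [CommRing R] {ε : Bicharacter G R}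
  [AddCommGroup L] [Module R L] {𝔤 : ColorLieAlgebra ε L}

namespace HomogeneousBasis

variable {I : Type*} (b : 𝔤.HomogeneousBasis I)

/-- The element of the tensor algebra given by a word in the basis. -/
def word (w : List I) : TensorAlgebra R L :=
  (w.map fun i => TensorAlgebra.ι R (b.basis i)).prod

@[simp]
theorem word_nil : b.word [] = 1 := rfl

theorem word_cons (i : I) (w : List I) :
    b.word (i :: w) = TensorAlgebra.ι R (b.basis i) * b.word w := by
  simp [word]

theorem word_append (u v : List I) : b.word (u ++ v) = b.word u * b.word v := by
  simp [word]

/-- The basis of the tensor algebra consisting of all words. -/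
def wordBasis : Module.Basis (List I) R (TensorAlgebra R L) :=
  b.basis.tensorAlgebra.reindex FreeMonoid.toList

@[simp]
theorem wordBasis_apply (w : List I) : b.wordBasis w = b.word w := by
  simp only [wordBasis, Module.Basis.reindex_apply, Module.Basis.tensorAlgebra,
    Module.Basis.map_apply, AlgEquiv.toLinearEquiv_apply]
  rw [AlgEquiv.symm_apply_eq]
  have : FreeAlgebra.basisFreeMonoid R I (FreeMonoid.toList.symm w) =
      (w.map (FreeAlgebra.ι R)).prod := by
    simp [FreeAlgebra.basisFreeMonoid, FreeAlgebra.equivMonoidAlgebraFreeMonoid,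
      FreeMonoid.lift_apply]
  rw [this, word, map_list_prod, List.map_map]
  congr 1
  refine List.map_congr_left fun i _ => ?_
  simp

variable (ω : 𝔤.Z2)

/-- The degree of a word. -/
def wordDeg (w : List I) : G := (w.map b.deg).sum

@[simp]
theorem wordDeg_nil : b.wordDeg [] = 0 := rfl

@[simp]
theorem wordDeg_cons (i : I) (w : List I) : b.wordDeg (i :: w) = b.deg i + b.wordDeg w := by
  simp [wordDeg]

@[simp]
theorem wordDeg_append (u v : List I) : b.wordDeg (u ++ v) = b.wordDeg u + b.wordDeg v := by
  simp [wordDeg]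

/-- The constant ω(x_i,x_j) multiplies the empty word, of degree 0, and is nonzero only when the two
degrees add up to 0. -/
theorem lowerPart_mem_span (i j : I) :
    𝔤.lowerPart ω (b.basis i) (b.basis j) ∈ Submodule.span R
      (b.word '' {a | a.length ≤ 1 ∧ b.wordDeg a = b.deg i + b.deg j}) := by
  refine add_mem ?_ ?_
  · have h := b.grading_le _ (𝔤.bracket_mem (b.mem_grading i) (b.mem_grading j))
    have := Submodule.mem_map_of_mem (f := TensorAlgebra.ι R) h
    rw [Submodule.map_span, ← Set.image_comp] at this
    refine Submodule.span_mono ?_ this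
    rintro _ ⟨k, hk, rfl⟩
    exact ⟨[k], ⟨by simp, by simpa using hk⟩, by simp [word]⟩
  · by_cases h : b.deg i + b.deg j = 0
    · rw [Algebra.algebraMap_eq_smul_one]
      exact Submodule.smul_mem _ _ (Submodule.subset_span ⟨[], ⟨by simp, h.symm⟩, rfl⟩)
    · rw [ω.2.1.1 _ _ _ _ (b.mem_grading i) (b.mem_grading j) h, map_zero]
      exact zero_mem _

section Rules

variable [LinearOrder I]

/-- The pairs of letters to which a rewriting rule applies. -/
def IsReducible (i j : I) : Prop := j < i ∨ (i = j ∧ b.odd i)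

/-- The right-hand side of the rewriting rule for a pair of letters. -/
def reduct [Algebra ℚ R] (i j : I) : TensorAlgebra R L :=
  -- This case is used only for odd `i`: there ε = -1 and the relation reads 2 x_i x_i = [x_i,x_i] +
  -- ω(x_i,x_i).
  if i = j then algebraMap ℚ R (1 / 2) • 𝔤.lowerPart ω (b.basis i) (b.basis j)
  else ε.val (b.deg i) (b.deg j) • b.word [j, i] + 𝔤.lowerPart ω (b.basis i) (b.basis j)

/-- The words in which no pair of adjacent letters is reducible. -/
def IsNormal (w : List I) : Prop :=
  ∀ u i j v, w = u ++ i :: j :: v → ¬ b.IsReducible i j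

/-- The words that can occur in the right-hand side of the rewriting rule for `i, j`. -/
def reductWords (i j : I) : Set (List I) :=
  {a | (a.length ≤ 1 ∨ (a = [j, i] ∧ j < i)) ∧ b.wordDeg a = b.deg i + b.deg j}

variable {b}

theorem reduct_mem_span [Algebra ℚ R] {i j : I} (h : b.IsReducible i j) :
    b.reduct ω i j ∈ Submodule.span R (b.word '' b.reductWords i j) := by
  have hl : 𝔤.lowerPart ω (b.basis i) (b.basis j) ∈
      Submodule.span R (b.word '' b.reductWords i j) := by
    refine Submodule.span_mono (Set.image_mono ?_) (b.lowerPart_mem_span ω i j)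
    exact fun a ha => ⟨Or.inl ha.1, ha.2⟩
  rw [reduct]
  split_ifs with hij
  · exact Submodule.smul_mem _ _ hl
  · have : j < i := by
      rcases h with h | h
      · exact h
      · exact absurd h.1 hij
    exact add_mem (Submodule.smul_mem _ _ (Submodule.subset_span
      ⟨[j, i], ⟨Or.inr ⟨rfl, this⟩, by simp [add_comm]⟩, rfl⟩)) hl

theorem smaller_of_mem_reductWords {i j : I} {a : List I} (ha : a ∈ b.reductWords i j)
    (u v : List I) : (u ++ a ++ v).Smaller (u ++ i :: j :: v) := by
  rcases ha.1 with ha | ⟨rfl, h⟩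
  · refine List.Smaller.of_length_lt ?_
    simp only [List.length_append, List.length_cons]
    omega
  · simpa using List.Smaller.swap u v h

variable (b)

/-- Two linear maps agreeing after substitution of the words of a rule agree on the reduct. -/
theorem eq_of_forall_reductWords [Algebra ℚ R] {M : Type*} [AddCommGroup M] [Module R M]
    {i j : I} (h : b.IsReducible i j) (f g : TensorAlgebra R L →ₗ[R] M)
    (hfg : ∀ a ∈ b.reductWords i j, f (b.word a) = g (b.word a)) :
    f (b.reduct ω i j) = g (b.reduct ω i j) := by
  have : Set.EqOn f g (b.word '' b.reductWords i j) := by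
    rintro _ ⟨a, ha, rfl⟩
    exact hfg a ha
  exact LinearMap.eqOn_span this (b.reduct_mem_span ω h)

/-- Every rule lowers the word order, which gives termination, and keeps the G-degree, which makes
normal forms compatible with the grading. -/
theorem reduct_context_mem_span [Algebra ℚ R] {i j : I} (h : b.IsReducible i j) (u v : List I) :
    b.word u * b.reduct ω i j * b.word v ∈
      Submodule.span R (b.word '' {w | w.Smaller (u ++ i :: j :: v) ∧
        b.wordDeg w = b.wordDeg (u ++ i :: j :: v)}) := by
  have := Submodule.mem_map_of_mem (f := LinearMap.mulRight R (b.word v) ∘ₗ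
    LinearMap.mulLeft R (b.word u)) (b.reduct_mem_span ω h)
  rw [Submodule.map_span, ← Set.image_comp] at this
  refine Submodule.span_mono ?_ this
  rintro _ ⟨a, ha, rfl⟩
  exact ⟨u ++ a ++ v, ⟨smaller_of_mem_reductWords ha u v, by simp [ha.2, add_assoc]⟩,
    by simp [word_append, mul_assoc]⟩

open Classical in
/-- The result of applying one rewriting rule to a word that is not normal. -/
def rewriteStep [Algebra ℚ R] (w : List I) : TensorAlgebra R L :=
  if h : ∃ p : List I × I × I × List I, w = p.1 ++ p.2.1 :: p.2.2.1 :: p.2.2.2 ∧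
    b.IsReducible p.2.1 p.2.2.1 then
    b.word h.choose.1 * b.reduct ω h.choose.2.1 h.choose.2.2.1 * b.word h.choose.2.2.2
  else b.word w

open Classical in
/-- The normal form of a word. -/
def normalWord [Algebra ℚ R] (w : List I) : TensorAlgebra R L :=
  if b.IsNormal w then b.word w
  else (b.wordBasis.repr (b.rewriteStep ω w)).sum fun w' c =>
    -- The test only serves the termination proof. It succeeds on the whole support of
    -- `rewriteStep`, as `exists_normalize_word` shows.
    if w'.Smaller w then c • normalWord w' else 0
termination_by (w.length, w.inversions)
decreasing_by assumption

/-- The normal form of an element of the tensor algebra. -/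
def normalize [Algebra ℚ R] : TensorAlgebra R L →ₗ[R] TensorAlgebra R L :=
  b.wordBasis.constr R (b.normalWord ω)

variable [Algebra ℚ R]

theorem normalize_word (w : List I) : b.normalize ω (b.word w) = b.normalWord ω w := by
  rw [normalize, ← wordBasis_apply, Module.Basis.constr_basis]

theorem normalize_word_of_isNormal {w : List I} (h : b.IsNormal w) :
    b.normalize ω (b.word w) = b.word w := by
  rw [normalize_word, normalWord, if_pos h]

/-- The recursion for normal forms, freed from its guard. The rule used is some arbitrary choice;
confluence removes the dependence on it. -/
theorem exists_normalize_word {w : List I} (h : ¬ b.IsNormal w) :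
    ∃ u i j v, w = u ++ i :: j :: v ∧ b.IsReducible i j ∧
      b.normalize ω (b.word w) = b.normalize ω (b.word u * b.reduct ω i j * b.word v) := by
  have h' : ∃ p : List I × I × I × List I, w = p.1 ++ p.2.1 :: p.2.2.1 :: p.2.2.2 ∧
      b.IsReducible p.2.1 p.2.2.1 := by
    simp only [IsNormal, not_forall, not_not] at h
    obtain ⟨u, i, j, v, e, hr⟩ := h
    exact ⟨(u, i, j, v), e, hr⟩
  refine ⟨_, _, _, _, h'.choose_spec.1, h'.choose_spec.2, ?_⟩
  have hm := b.reduct_context_mem_span ω h'.choose_spec.2 h'.choose.1 h'.choose.2.2.2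
  rw [← h'.choose_spec.1] at hm
  have he : b.rewriteStep ω w = b.word h'.choose.1 *
      b.reduct ω h'.choose.2.1 h'.choose.2.2.1 * b.word h'.choose.2.2.2 := dif_pos h'
  rw [← he] at hm ⊢
  rw [normalize_word, normalWord, if_neg h, normalize, Module.Basis.constr_apply]
  refine Finsupp.sum_congr fun w' hw' => if_pos ?_
  rw [← funext b.wordBasis_apply] at hm
  exact (b.wordBasis.repr_support_subset_of_mem_span _ hm hw').1

end Rules

end HomogeneousBasis

end ColorLieAlgebra

/-! ### Confluence: the diamond lemma. -/

namespace ColorLieAlgebra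

variable {G R L : Type*} [AddCommGroup G] [DecidableEq G] [CommRing R] {ε : Bicharacter G R}
  [AddCommGroup L] [Module R L] {𝔤 : ColorLieAlgebra ε L}

namespace HomogeneousBasis

variable {I : Type*} (b : 𝔤.HomogeneousBasis I) (ω : 𝔤.Z2)

section Confluence

variable [LinearOrder I] [Algebra ℚ R]

/-- The normal form of `w` can be computed by starting with any applicable rule. -/
def IsConfluent (w : List I) : Prop :=
  ∀ u i j v, w = u ++ i :: j :: v → b.IsReducible i j →
    b.normalize ω (b.word w) = b.normalize ω (b.word u * b.reduct ω i j * b.word v)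

/-- The linear map `t ↦ normalize (u t v)`. -/
def normalizeContext (u v : List I) : TensorAlgebra R L →ₗ[R] TensorAlgebra R L :=
  b.normalize ω ∘ₗ LinearMap.mulRight R (b.word v) ∘ₗ LinearMap.mulLeft R (b.word u)

theorem normalizeContext_apply (u v : List I) (t : TensorAlgebra R L) :
    b.normalizeContext ω u v t = b.normalize ω (b.word u * t * b.word v) := rfl

theorem normalizeContext_mul_ι (u v : List I) (t : TensorAlgebra R L) (i : I) :
    b.normalizeContext ω u v (t * TensorAlgebra.ι R (b.basis i)) =
      b.normalizeContext ω u (i :: v) t := by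
  simp only [normalizeContext_apply, word_cons, mul_assoc]

theorem normalizeContext_ι_mul (u v : List I) (t : TensorAlgebra R L) (i : I) :
    b.normalizeContext ω u v (TensorAlgebra.ι R (b.basis i) * t) =
      b.normalizeContext ω (u ++ [i]) v t := by
  simp only [normalizeContext_apply, word_append, word_cons, word_nil, mul_one, mul_assoc]

theorem normalizeContext_word (u v w : List I) :
    b.normalizeContext ω u v (b.word w) = b.normalize ω (b.word (u ++ w ++ v)) := by
  simp only [normalizeContext_apply, word_append]

variable {b ω}

theorem IsConfluent.normalizeContext_eq {u v : List I} {i j : I}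
    (h : b.IsConfluent ω (u ++ i :: j :: v)) (hij : b.IsReducible i j) :
    b.normalizeContext ω u v (TensorAlgebra.ι R (b.basis i) * TensorAlgebra.ι R (b.basis j)) =
      b.normalizeContext ω u v (b.reduct ω i j) := by
  have := h u i j v rfl hij
  rw [word_append, word_cons, word_cons, ← mul_assoc (TensorAlgebra.ι R _), ← mul_assoc] at this
  exact this

theorem two_smul_reduct_self (i : I) :
    (2 : R) • b.reduct ω i i = 𝔤.lowerPart ω (b.basis i) (b.basis i) := by
  rw [reduct, if_pos rfl, smul_smul, ← map_ofNat (algebraMap ℚ R) 2, ← map_mul,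
    mul_one_div_cancel two_ne_zero, map_one, one_smul]

theorem reduct_of_lt {i j : I} (h : j < i) :
    b.reduct ω i j = ε.val (b.deg i) (b.deg j) •
      (TensorAlgebra.ι R (b.basis j) * TensorAlgebra.ι R (b.basis i)) +
        𝔤.lowerPart ω (b.basis i) (b.basis j) := by
  rw [reduct, if_neg h.ne', word_cons, word_cons, word_nil, mul_one]

/-- Confluence for a decreasing pair. -/
theorem IsConfluent.swap {u v : List I} {i j : I}
    (h : b.IsConfluent ω (u ++ i :: j :: v)) (hij : j < i) :
    b.normalizeContext ω u v (TensorAlgebra.ι R (b.basis i) * TensorAlgebra.ι R (b.basis j)) =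
      ε.val (b.deg i) (b.deg j) • b.normalizeContext ω u v
        (TensorAlgebra.ι R (b.basis j) * TensorAlgebra.ι R (b.basis i)) +
      b.normalizeContext ω u v (𝔤.lowerPart ω (b.basis i) (b.basis j)) := by
  rw [h.normalizeContext_eq (Or.inl hij), reduct_of_lt hij, map_add, map_smul]

theorem IsConfluent.square {u v : List I} {i : I}
    (h : b.IsConfluent ω (u ++ i :: i :: v)) (hi : b.odd i) :
    (2 : R) • b.normalizeContext ω u v
        (TensorAlgebra.ι R (b.basis i) * TensorAlgebra.ι R (b.basis i)) =
      b.normalizeContext ω u v (𝔤.lowerPart ω (b.basis i) (b.basis i)) := by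
  rw [h.normalizeContext_eq (Or.inr ⟨rfl, hi⟩), ← map_smul, two_smul_reduct_self]

/-- For a decreasing pair or an odd square the relator is a multiple of the difference of the two
sides of a rule; for an even square it is zero. -/
theorem normalizeContext_relator_basis_of_le {u v : List I} {i j : I} (hij : j ≤ i)
    (h : b.IsConfluent ω (u ++ i :: j :: v)) :
    b.normalizeContext ω u v
      (𝔤.relator ω (b.deg i) (b.deg j) (b.basis i) (b.basis j)) = 0 := by
  rcases hij.lt_or_eq with hij | rfl
  · rw [relator, map_sub, map_sub, map_smul, h.swap hij]
    abel
  · by_cases hj : b.odd j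
    · rw [relator, b.val_of_odd j hj, map_sub, map_sub, ← h.square hj, map_smul]
      module
    · rw [relator, b.val_of_not_odd j hj, lowerPart_self ω (b.mem_grading j)
        (b.val_of_not_odd j hj), one_smul, sub_self, sub_zero, map_zero]

/-- The second argument must be a general homogeneous vector because `overlap_eq` produces relators
of a letter with a bracket. Linearity reduces it to a letter, and `relator_skew` puts the two
letters in decreasing order. -/
theorem normalizeContext_relator {u v : List I}
    (h : ∀ w : List I, w.length ≤ u.length + v.length + 2 → b.IsConfluent ω w) (i : I) {k : G}
    {y : L} (hy : y ∈ 𝔤.grading k) :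
    b.normalizeContext ω u v (𝔤.relator ω (b.deg i) k (b.basis i) y) = 0 := by
  have hc : ∀ i j, b.IsConfluent ω (u ++ i :: j :: v) := fun i j =>
    h _ (by simp only [List.length_append, List.length_cons]; omega)
  have hy' := b.grading_le k hy
  induction hy' using Submodule.span_induction with
  | mem y hy' =>
    obtain ⟨j, rfl, rfl⟩ := hy'
    rcases le_total j i with hij | hij
    · exact normalizeContext_relator_basis_of_le hij (hc i j)
    · rw [relator_skew ω (b.mem_grading i) (b.mem_grading j), map_neg, map_smul,
        normalizeContext_relator_basis_of_le hij (hc j i), smul_zero, neg_zero]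
  | zero => simp [relator, lowerPart]
  | add x y hx hz hx' hz' =>
    have : ∀ x ∈ Submodule.span R (b.basis '' {i | b.deg i = k}), x ∈ 𝔤.grading k := by
      intro x hx
      refine Submodule.span_le.2 ?_ hx
      rintro _ ⟨j, rfl, rfl⟩
      exact b.mem_grading j
    have e : 𝔤.relator ω (b.deg i) k (b.basis i) (x + y) =
        𝔤.relator ω (b.deg i) k (b.basis i) x + 𝔤.relator ω (b.deg i) k (b.basis i) y := by
      simp only [relator, lowerPart, map_add, mul_add, add_mul, smul_add]
      abel
    rw [e, map_add, hx' (this x hx), hz' (this y hz), add_zero]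
  | smul r x hx hx' =>
    have : x ∈ 𝔤.grading k := by
      refine Submodule.span_le.2 ?_ hx
      rintro _ ⟨j, rfl, rfl⟩
      exact b.mem_grading j
    have e : 𝔤.relator ω (b.deg i) k (b.basis i) (r • x) =
        r • 𝔤.relator ω (b.deg i) k (b.basis i) x := by
      simp only [relator, lowerPart, map_smul, smul_eq_mul, map_mul, smul_sub, smul_add,
        mul_smul_comm, smul_mul_assoc, Algebra.smul_def r (algebraMap R (TensorAlgebra R L) _)]
      rw [smul_comm]
    rw [e, map_smul, hx' this, smul_zero]

/-- The relators on the right of `overlap_eq` have tensor degree at most two, one less than the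
overlap, so confluence in smaller length kills them. -/
theorem normalizeContext_overlap {u v : List I} (i j k : I)
    (h : ∀ w : List I, w.length ≤ u.length + v.length + 2 → b.IsConfluent ω w) :
    (ε.val (b.deg i) (b.deg j) * ε.val (b.deg i) (b.deg k)) •
        b.normalizeContext ω u (i :: v) (𝔤.lowerPart ω (b.basis j) (b.basis k))
      - b.normalizeContext ω (u ++ [i]) v (𝔤.lowerPart ω (b.basis j) (b.basis k))
      + ε.val (b.deg i) (b.deg j) •
        b.normalizeContext ω (u ++ [j]) v (𝔤.lowerPart ω (b.basis i) (b.basis k))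
      - ε.val (b.deg j) (b.deg k) •
        b.normalizeContext ω u (j :: v) (𝔤.lowerPart ω (b.basis i) (b.basis k))
      + b.normalizeContext ω u (k :: v) (𝔤.lowerPart ω (b.basis i) (b.basis j))
      - (ε.val (b.deg j) (b.deg k) * ε.val (b.deg i) (b.deg k)) •
        b.normalizeContext ω (u ++ [k]) v (𝔤.lowerPart ω (b.basis i) (b.basis j)) = 0 := by
  have hm := b.mem_grading
  have := congrArg (b.normalizeContext ω u v) (overlap_eq ω (hm i) (hm j) (hm k))
  simp only [map_add, map_sub, map_smul, map_neg, normalizeContext_mul_ι,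
    normalizeContext_ι_mul] at this
  rw [this, normalizeContext_relator h i (𝔤.bracket_mem (hm j) (hm k)),
    normalizeContext_relator h j (𝔤.bracket_mem (hm i) (hm k)),
    normalizeContext_relator h k (𝔤.bracket_mem (hm i) (hm j))]
  simp

/-- The two ways to rewrite an overlap `i j k` give the same normal form. -/
theorem normalizeContext_reduct_overlap {u v : List I} {i j k : I}
    (h : ∀ w : List I, w.Smaller (u ++ i :: j :: k :: v) → b.IsConfluent ω w)
    (hij : b.IsReducible i j) (hjk : b.IsReducible j k) :
    b.normalizeContext ω u (k :: v) (b.reduct ω i j) =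
      b.normalizeContext ω (u ++ [i]) v (b.reduct ω j k) := by
  have hl : ∀ w : List I, w.length ≤ u.length + v.length + 2 → b.IsConfluent ω w := fun w hw =>
    h w (List.Smaller.of_length_lt (by simp only [List.length_append, List.length_cons]; omega))
  have key := normalizeContext_overlap i j k hl
  -- A cubic term can be read with either its last or its first letter absorbed into the context.
  have bridge : ∀ p q r : I, b.normalizeContext ω u (r :: v)
      (TensorAlgebra.ι R (b.basis p) * TensorAlgebra.ι R (b.basis q)) =
      b.normalizeContext ω (u ++ [p]) v
        (TensorAlgebra.ι R (b.basis q) * TensorAlgebra.ι R (b.basis r)) := fun p q r => by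
    rw [← normalizeContext_mul_ι, ← normalizeContext_ι_mul, mul_assoc]
  have hc : ∀ p q r : I, (u ++ p :: q :: r :: v).Smaller (u ++ i :: j :: k :: v) →
      b.IsConfluent ω ((u ++ [p]) ++ q :: r :: v) := fun p q r hs => h _ (by simpa using hs)
  have right : ∀ (p : I) {q r : I}, r < q →
      (u ++ p :: r :: q :: v).Smaller (u ++ p :: q :: r :: v) := fun p q r hqr => by
    simpa using List.Smaller.swap (u ++ [p]) v hqr
  have left : ∀ {p q : I} (r : I), q < p →
      (u ++ q :: p :: r :: v).Smaller (u ++ p :: q :: r :: v) := fun r hpq =>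
    List.Smaller.swap u (r :: v) hpq
  rcases hij with hij | ⟨rfl, hi⟩ <;> rcases hjk with hjk | ⟨rfl, hj⟩
  -- Both routes end at `k j i`: i j k → j i k → j k i → k j i, and i j k → i k j → k i j → k j i.
  -- The accumulated lower parts differ by `key`.
  · have hik := hjk.trans hij
    have s1 := (hc j i k (left k hij)).swap hik
    have s2 := (h _ ((right j hik).trans (left k hij))).swap (u := u) (v := i :: v) hjk
    have s3 := (h _ (right i hjk)).swap (u := u) (v := j :: v) hik
    have s4 := (hc k i j ((left j hik).trans (right i hjk))).swap hij
    rw [reduct_of_lt hij, reduct_of_lt hjk]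
    simp only [map_add, map_smul]
    rw [bridge j i k, s1, ← bridge j k i, s2, ← bridge i k j, s3, bridge k i j, s4,
      ← bridge k j i]
    linear_combination (norm := module) key
  -- Here `i` moves past both copies of the odd letter, i j j → j i j → j j i. Doubling clears the
  -- one half in the rule for j j. The next case is the mirror image.
  · have s1 := (hc j i j (left j hij)).swap hij
    have s2 := (h _ ((right j hij).trans (left j hij))).square (u := u) (v := i :: v) hj
    rw [b.val_of_odd j hj] at key
    refine eq_of_two_smul_eq (R := R) ?_
    rw [← map_smul _ (2 : R) (b.reduct ω j j), two_smul_reduct_self, reduct_of_lt hij]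
    simp only [map_add, map_smul]
    rw [bridge j i j, s1, ← bridge j j i]
    linear_combination (norm := module) key + (ε.val (b.deg i) (b.deg j) *
      ε.val (b.deg i) (b.deg j)) • s2
  · have s1 := (h _ (right i hjk)).swap (u := u) (v := i :: v) hjk
    have s2 := (hc k i i ((left i hjk).trans (right i hjk))).square hi
    rw [b.val_of_odd i hi] at key
    refine eq_of_two_smul_eq (R := R) ?_
    rw [← map_smul _ (2 : R) (b.reduct ω i i), two_smul_reduct_self, reduct_of_lt hjk]
    simp only [map_add, map_smul]
    rw [← bridge i k i, s1, bridge k i i]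
    linear_combination (norm := module) key - (ε.val (b.deg i) (b.deg k) *
      ε.val (b.deg i) (b.deg k)) • s2
  -- For the cube of an odd letter all signs are -1, and `key` is three times the wanted identity,
  -- doubled: the analogue of 3[x,[x,x]] = 0.
  · rw [b.val_of_odd i hi] at key
    refine eq_of_two_smul_eq (R := R) (eq_of_three_smul_eq (R := R) ?_)
    rw [← map_smul _ (2 : R) (b.reduct ω i i), ← map_smul _ (2 : R) (b.reduct ω i i),
      two_smul_reduct_self]
    linear_combination (norm := module) key

/-- After one rule has been applied only smaller words occur, where the other rule may be used by
the inductive hypothesis. Either order leads to the normal form of the element with both pairs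
replaced. -/
theorem normalize_disjoint {u m v : List I} {i j k l : I}
    (h : ∀ w : List I, w.Smaller (u ++ i :: j :: (m ++ k :: l :: v)) → b.IsConfluent ω w)
    (hij : b.IsReducible i j) (hkl : b.IsReducible k l) :
    b.normalize ω (b.word u * b.reduct ω i j * b.word (m ++ k :: l :: v)) =
      b.normalize ω (b.word (u ++ i :: j :: m) * b.reduct ω k l * b.word v) := by
  have h1 := b.eq_of_forall_reductWords ω hij (b.normalizeContext ω u (m ++ k :: l :: v))
    (b.normalize ω ∘ₗ LinearMap.mulRight R (b.word m * b.reduct ω k l * b.word v) ∘ₗ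
      LinearMap.mulLeft R (b.word u)) (fun a ha => by
      rw [normalizeContext_word, h _ (smaller_of_mem_reductWords ha u _) (u ++ a ++ m) k l v
        (by simp) hkl]
      simp [word_append, mul_assoc])
  have h2 := b.eq_of_forall_reductWords ω hkl (b.normalizeContext ω (u ++ i :: j :: m) v)
    (b.normalize ω ∘ₗ LinearMap.mulRight R (b.word v) ∘ₗ
      LinearMap.mulLeft R (b.word u * b.reduct ω i j * b.word m)) (fun a ha => by
      have hs := smaller_of_mem_reductWords ha (u ++ i :: j :: m) v
      rw [normalizeContext_word, h _ (by simpa using hs) u i j (m ++ a ++ v) (by simp) hij]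
      simp [word_append, mul_assoc])
  rw [normalizeContext_apply] at h1 h2
  rw [h1, h2]
  simp [mul_assoc]

variable (b ω)

/-- The word `m` separating the starting points of the two redexes decides the case: empty means the
same redex, one letter means an overlap, and two or more mean disjoint redexes. -/
theorem normalize_reduct_eq {w : List I} (h : ∀ w' : List I, w'.Smaller w → b.IsConfluent ω w')
    {u v u' v' : List I} {i j i' j' : I} (hl : u.length ≤ u'.length) (e : w = u ++ i :: j :: v)
    (e' : w = u' ++ i' :: j' :: v') (hij : b.IsReducible i j) (hij' : b.IsReducible i' j') :
    b.normalize ω (b.word u * b.reduct ω i j * b.word v) =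
      b.normalize ω (b.word u' * b.reduct ω i' j' * b.word v') := by
  obtain ⟨m, rfl⟩ : u <+: u' :=
    List.prefix_of_prefix_length_le (l₃ := w) ⟨_, e.symm⟩ ⟨_, e'.symm⟩ hl
  subst e
  rw [List.append_assoc, List.append_cancel_left_eq] at e'
  rcases m with _ | ⟨p, _ | ⟨q, m⟩⟩
  · simp only [List.nil_append, List.cons.injEq] at e'
    obtain ⟨rfl, rfl, rfl⟩ := e'
    rw [List.append_nil]
  · simp only [List.singleton_append, List.cons.injEq] at e'
    obtain ⟨rfl, rfl, rfl⟩ := e'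
    rw [← normalizeContext_apply, ← normalizeContext_apply]
    exact normalizeContext_reduct_overlap h hij hij'
  · simp only [List.cons_append, List.cons.injEq] at e'
    obtain ⟨rfl, rfl, rfl⟩ := e'
    exact normalize_disjoint h hij hij'

/-- Well-founded induction, comparing an arbitrary redex with the one chosen in the definition of
the normal form. -/
theorem isConfluent (w : List I) : b.IsConfluent ω w := by
  refine List.smaller_wf.induction (C := b.IsConfluent ω) w fun w ih => ?_
  intro u i j v e hij
  have hn : ¬ b.IsNormal w := fun hn => hn u i j v e hij
  obtain ⟨u', i', j', v', e', hij', h⟩ := b.exists_normalize_word ω hn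
  rw [h]
  rcases le_total u.length u'.length with hl | hl
  · exact (b.normalize_reduct_eq ω ih hl e e' hij hij').symm
  · exact b.normalize_reduct_eq ω ih hl e' e hij' hij

/-- Normal forms are compatible with the defining relations of the enveloping algebra. -/
theorem normalize_relator {g k : G} {x y : L} (hx : x ∈ 𝔤.grading g) (hy : y ∈ 𝔤.grading k)
    (s t : TensorAlgebra R L) : b.normalize ω (s * 𝔤.relator ω g k x y * t) = 0 := by
  have hw : ∀ u v : List I, b.normalizeContext ω u v (𝔤.relator ω g k x y) = 0 := by
    intro u v
    have hx' := b.grading_le g hx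
    -- Exchanging the arguments puts `x` in the second slot, where the relator is a linear map `f`
    -- of it; on basis vectors the exchange is undone and `normalizeContext_relator` applies.
    rw [relator_skew ω hx hy, map_neg, map_smul]
    suffices ∀ x ∈ Submodule.span R (b.basis '' {i | b.deg i = g}),
        b.normalizeContext ω u v (𝔤.relator ω k g y x) = 0 by rw [this x hx', smul_zero, neg_zero]
    intro x hx
    let f : L →ₗ[R] TensorAlgebra R L := LinearMap.mulLeft R (TensorAlgebra.ι R y) ∘ₗ
      TensorAlgebra.ι R - ε.val k g • LinearMap.mulRight R (TensorAlgebra.ι R y) ∘ₗ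
      TensorAlgebra.ι R - (TensorAlgebra.ι R ∘ₗ 𝔤.bracket y +
        Algebra.linearMap R (TensorAlgebra R L) ∘ₗ ω.1 y)
    have hf : ∀ x, 𝔤.relator ω k g y x = f x := fun x => by
      simp [f, relator, lowerPart]
    rw [hf]
    have : Submodule.span R (b.basis '' {i | b.deg i = g}) ≤
        LinearMap.ker (b.normalizeContext ω u v ∘ₗ f) := by
      refine Submodule.span_le.2 ?_
      rintro _ ⟨i, rfl, rfl⟩
      rw [SetLike.mem_coe, LinearMap.mem_ker, LinearMap.comp_apply, ← hf,
        relator_skew ω hy (b.mem_grading i), map_neg, map_smul,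
        normalizeContext_relator (fun w _ => b.isConfluent ω w) i hy, smul_zero, neg_zero]
    exact this hx
  have h1 : ∀ u : List I, ∀ t, b.normalize ω (b.word u * 𝔤.relator ω g k x y * t) = 0 := by
    intro u
    have : b.normalize ω ∘ₗ LinearMap.mulLeft R (b.word u * 𝔤.relator ω g k x y) = 0 :=
      b.wordBasis.ext fun v => by
        simpa [normalizeContext_apply, mul_assoc] using hw u v
    exact fun t => LinearMap.congr_fun this t
  have h2 : b.normalize ω ∘ₗ LinearMap.mulRight R t ∘ₗ
      LinearMap.mulRight R (𝔤.relator ω g k x y) = 0 :=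
    b.wordBasis.ext fun u => by
      simpa [mul_assoc] using h1 u t
  exact LinearMap.congr_fun h2 s

end Confluence

end HomogeneousBasis

end ColorLieAlgebra

/-! ### The Poincaré–Birkhoff–Witt basis of a twisted enveloping algebra. -/

namespace ColorLieAlgebra

variable {G R L : Type*} [AddCommGroup G] [DecidableEq G] [CommRing R] {ε : Bicharacter G R}
  [AddCommGroup L] [Module R L] (𝔤 : ColorLieAlgebra ε L)

/-- The two-sided ideal generated by the relators `x y - ε y x - [x, y] - ω(x, y)`. -/
def relatorIdeal (ω : 𝔤.Z2) : TwoSidedIdeal (TensorAlgebra R L) :=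
  TwoSidedIdeal.span {u | ∃ (g h : G) (a b : L), a ∈ 𝔤.grading g ∧ b ∈ 𝔤.grading h ∧
    u = 𝔤.relator ω g h a b}

/-- The linear map `f : L → A` exhibits `A` as the quotient of the tensor algebra by the
two-sided ideal generated by the relators. -/
structure IsTwistedEnveloping (ω : 𝔤.Z2) {A : Type*} [Ring A] [Algebra R A] (f : L →ₗ[R] A) :
    Prop where
  surjective : Function.Surjective (TensorAlgebra.lift R f)
  lift_eq_zero_iff : ∀ t, TensorAlgebra.lift R f t = 0 ↔ t ∈ 𝔤.relatorIdeal ω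

namespace HomogeneousBasis

variable {𝔤} {I : Type*} (b : 𝔤.HomogeneousBasis I) (ω : 𝔤.Z2) [LinearOrder I]

/-- The normal words, indexing the Poincaré–Birkhoff–Witt basis. -/
abbrev NormalWord : Type _ := {w : List I // b.IsNormal w}

section Normalize

variable [Algebra ℚ R]

/-- The kernel of `normalize` is not visibly an ideal. The elements killed in every two-sided
context do form one, and it contains the relators. -/
theorem normalize_eq_zero {t : TensorAlgebra R L} (ht : t ∈ 𝔤.relatorIdeal ω) :
    b.normalize ω t = 0 := by
  let J : TwoSidedIdeal (TensorAlgebra R L) :=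
    TwoSidedIdeal.mk' {t | ∀ u v, b.normalize ω (u * t * v) = 0} (by simp)
      (fun {x y} hx hy u v => by rw [mul_add, add_mul, map_add, hx u v, hy u v, add_zero])
      (fun {x} hx u v => by rw [mul_neg, neg_mul, map_neg, hx u v, neg_zero])
      (fun {x y} hy u v => by rw [← mul_assoc]; exact hy (u * x) v)
      (fun {x y} hx u v => by rw [← mul_assoc, mul_assoc _ y]; exact hx u (y * v))
  have hJ : ∀ t, t ∈ J ↔ ∀ u v, b.normalize ω (u * t * v) = 0 := fun t =>
    TwoSidedIdeal.mem_mk' ..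
  have : 𝔤.relatorIdeal ω ≤ J := by
    refine TwoSidedIdeal.span_le.2 ?_
    rintro _ ⟨g, h, x, y, hx, hy, rfl⟩
    exact (hJ _).2 (b.normalize_relator ω hx hy)
  simpa using (hJ t).1 (this ht) 1 1

theorem normalize_word_mem (w : List I) : b.normalize ω (b.word w) ∈ Submodule.span R
    (b.word '' {w' | b.IsNormal w' ∧ b.wordDeg w' = b.wordDeg w}) := by
  refine List.smaller_wf.induction (C := fun w => b.normalize ω (b.word w) ∈ Submodule.span R
    (b.word '' {w' | b.IsNormal w' ∧ b.wordDeg w' = b.wordDeg w})) w fun w ih => ?_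
  by_cases hw : b.IsNormal w
  · rw [b.normalize_word_of_isNormal ω hw]
    exact Submodule.subset_span ⟨w, ⟨hw, rfl⟩, rfl⟩
  · obtain ⟨u, i, j, v, e, hij, h⟩ := b.exists_normalize_word ω hw
    rw [h]
    have := Submodule.mem_map_of_mem (f := b.normalize ω) (b.reduct_context_mem_span ω hij u v)
    refine (Submodule.map_span_le _ _ _).2 ?_ this
    rintro _ ⟨w', ⟨hs, hd⟩, rfl⟩
    have := ih w' (e ▸ hs)
    rwa [hd, ← e] at this

end Normalize

variable {A : Type*} [Ring A] [Algebra R A] {f : L →ₗ[R] A}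

theorem lift_relator (hf : 𝔤.IsTwistedEnveloping ω f) {g h : G} {x y : L}
    (hx : x ∈ 𝔤.grading g) (hy : y ∈ 𝔤.grading h) :
    TensorAlgebra.lift R f (𝔤.relator ω g h x y) = 0 :=
  (hf.lift_eq_zero_iff _).2 (TwoSidedIdeal.subset_span ⟨g, h, x, y, hx, hy, rfl⟩)

variable [Algebra ℚ R]

theorem lift_reduct (hf : 𝔤.IsTwistedEnveloping ω f) {i j : I} (hij : b.IsReducible i j) :
    TensorAlgebra.lift R f (b.reduct ω i j) = f (b.basis i) * f (b.basis j) := by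
  have h := lift_relator ω hf (b.mem_grading i) (b.mem_grading j)
  simp only [relator, map_sub, map_mul, map_smul, TensorAlgebra.lift_ι_apply] at h
  rcases hij with hij | ⟨rfl, hi⟩
  · rw [reduct_of_lt hij]
    simp only [map_add, map_mul, map_smul, TensorAlgebra.lift_ι_apply]
    linear_combination (norm := module) -h
  · rw [b.val_of_odd i hi] at h
    have h2 := congrArg (TensorAlgebra.lift R f) (b.two_smul_reduct_self (ω := ω) i)
    rw [map_smul] at h2
    refine eq_of_two_smul_eq (R := R) ?_
    linear_combination (norm := module) h2 - h

/-- Each rule is an equality in `A`, so rewriting does not change the image. This gives the spanning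
half of the theorem. -/
theorem lift_normalize (hf : 𝔤.IsTwistedEnveloping ω f) (t : TensorAlgebra R L) :
    TensorAlgebra.lift R f (b.normalize ω t) = TensorAlgebra.lift R f t := by
  have : (TensorAlgebra.lift R f).toLinearMap ∘ₗ b.normalize ω =
      (TensorAlgebra.lift R f).toLinearMap := by
    refine b.wordBasis.ext fun w => ?_
    simp only [wordBasis_apply, LinearMap.comp_apply, AlgHom.toLinearMap_apply]
    refine List.smaller_wf.induction (C := fun w => TensorAlgebra.lift R f
      (b.normalize ω (b.word w)) = TensorAlgebra.lift R f (b.word w)) w fun w ih => ?_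
    by_cases hw : b.IsNormal w
    · rw [b.normalize_word_of_isNormal ω hw]
    · obtain ⟨u, i, j, v, e, hij, h⟩ := b.exists_normalize_word ω hw
      have hs : Set.EqOn ((TensorAlgebra.lift R f).toLinearMap ∘ₗ b.normalize ω)
          (TensorAlgebra.lift R f).toLinearMap
          (b.word '' {w' | w'.Smaller w ∧ b.wordDeg w' = b.wordDeg w}) := by
        rintro _ ⟨w', hw', rfl⟩
        exact ih w' hw'.1
      have hm := b.reduct_context_mem_span ω hij u v
      rw [← e] at hm
      rw [h]
      refine (LinearMap.eqOn_span hs hm).trans ?_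
      rw [AlgHom.toLinearMap_apply, map_mul, map_mul, b.lift_reduct ω hf hij, e, word_append,
        word_cons, word_cons]
      simp only [map_mul, TensorAlgebra.lift_ι_apply, mul_assoc]
  exact LinearMap.congr_fun this t

variable (f) in
/-- The monomial in `A` given by a word. -/
def monomial (w : List I) : A := TensorAlgebra.lift R f (b.word w)

variable (f) in
/-- The span of the monomials of a given degree. -/
def monomialSpan (g : G) : Submodule R A :=
  Submodule.span R (b.monomial f '' {w | b.wordDeg w = g})

/-- A relation among normal monomials lifts to a combination of normal words in the relator ideal.
`normalize` kills the ideal but fixes normal words, so the combination is zero already among words.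
-/
theorem linearIndependent_monomial (hf : 𝔤.IsTwistedEnveloping ω f) :
    LinearIndependent R fun w : b.NormalWord => b.monomial f w.1 := by
  have h0 : LinearIndependent R fun w : b.NormalWord => b.word w.1 := by
    have := b.wordBasis.linearIndependent.comp (fun w : b.NormalWord => w.1)
      Subtype.val_injective
    simpa [Function.comp_def] using this
  rw [linearIndependent_iff] at h0 ⊢
  intro c hc
  refine h0 c ?_
  have h1 : TensorAlgebra.lift R f
      (Finsupp.linearCombination R (fun w : b.NormalWord => b.word w.1) c) = 0 := by
    rw [← hc, Finsupp.linearCombination_apply, Finsupp.linearCombination_apply, Finsupp.sum,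
      Finsupp.sum, map_sum]
    simp [monomial]
  have h2 := b.normalize_eq_zero ω ((hf.lift_eq_zero_iff _).1 h1)
  rw [← h2, Finsupp.linearCombination_apply, Finsupp.sum, map_sum]
  refine Finset.sum_congr rfl fun w _ => ?_
  rw [map_smul, b.normalize_word_of_isNormal ω w.2]

theorem monomial_mem_span (hf : 𝔤.IsTwistedEnveloping ω f) (w : List I) :
    b.monomial f w ∈ Submodule.span R ((fun w : b.NormalWord => b.monomial f w.1) ''
      {w' | b.wordDeg w'.1 = b.wordDeg w}) := by
  have := Submodule.mem_map_of_mem (f := (TensorAlgebra.lift R f).toLinearMap)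
    (b.normalize_word_mem ω w)
  rw [AlgHom.toLinearMap_apply, b.lift_normalize ω hf, Submodule.map_span, ← Set.image_comp]
    at this
  refine Submodule.span_mono ?_ this
  rintro _ ⟨w', ⟨hn, hd⟩, rfl⟩
  exact ⟨⟨w', hn⟩, hd, rfl⟩

/-- The Poincaré–Birkhoff–Witt basis. -/
def pbwBasis (hf : 𝔤.IsTwistedEnveloping ω f) : Module.Basis b.NormalWord R A :=
  Module.Basis.mk (b.linearIndependent_monomial ω hf) (by
    rintro x -
    obtain ⟨t, rfl⟩ := hf.surjective x
    have ht := b.wordBasis.mem_span t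
    have := Submodule.mem_map_of_mem (f := (TensorAlgebra.lift R f).toLinearMap) ht
    refine (Submodule.map_span_le _ _ _).2 ?_ this
    rintro _ ⟨w, rfl⟩
    rw [wordBasis_apply]
    exact Submodule.span_mono (Set.image_subset_range _ _) (b.monomial_mem_span ω hf w))

@[simp]
theorem pbwBasis_apply (hf : 𝔤.IsTwistedEnveloping ω f) (w : b.NormalWord) :
    b.pbwBasis ω hf w = b.monomial f w.1 := by
  simp [pbwBasis]

theorem monomialSpan_eq (hf : 𝔤.IsTwistedEnveloping ω f) (g : G) :
    b.monomialSpan f g =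
      Submodule.span R (b.pbwBasis ω hf '' {w | b.wordDeg w.1 = g}) := by
  refine le_antisymm (Submodule.span_le.2 ?_) (Submodule.span_le.2 ?_)
  · rintro _ ⟨w, rfl, rfl⟩
    have := b.monomial_mem_span ω hf w
    rwa [← funext (b.pbwBasis_apply ω hf)] at this
  · rintro _ ⟨w, rfl, rfl⟩
    rw [pbwBasis_apply]
    exact Submodule.subset_span ⟨w.1, rfl, rfl⟩

end HomogeneousBasis

namespace HomogeneousBasis

variable {𝔤} {I : Type*} (b : 𝔤.HomogeneousBasis I) {A : Type*} [Ring A] [Algebra R A]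
  (f : L →ₗ[R] A)

theorem monomial_nil : b.monomial f [] = 1 := map_one _

theorem monomial_cons (i : I) (w : List I) :
    b.monomial f (i :: w) = f (b.basis i) * b.monomial f w := by
  simp [monomial, word_cons]

theorem one_mem_monomialSpan : 1 ∈ b.monomialSpan f 0 :=
  Submodule.subset_span ⟨[], rfl, map_one _⟩

theorem mul_mem_monomialSpan {g h : G} {x : L} {a : A} (hx : x ∈ 𝔤.grading g)
    (ha : a ∈ b.monomialSpan f h) : f x * a ∈ b.monomialSpan f (g + h) := by
  have h1 : f x ∈ Submodule.span R (f '' (b.basis '' {i | b.deg i = g})) := by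
    rw [← Submodule.map_span]
    exact Submodule.mem_map_of_mem (b.grading_le g hx)
  have := Submodule.mul_mem_mul h1 ha
  rw [monomialSpan, Submodule.span_mul_span] at this
  refine Submodule.span_mono ?_ this
  rintro _ ⟨_, ⟨_, ⟨i, rfl, rfl⟩, rfl⟩, _, ⟨w, rfl, rfl⟩, rfl⟩
  exact ⟨i :: w, by simp, b.monomial_cons f i w⟩

theorem isHomogeneousTensor_word (w : List I) :
    𝔤.IsHomogeneousTensor (b.wordDeg w) (b.word w) := by
  induction w with
  | nil => exact .one
  | cons i w ih =>
    rw [word_cons, wordDeg_cons]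
    exact .cons (b.mem_grading i) ih

end HomogeneousBasis

end ColorLieAlgebra

/-! ### Presentations of `U` and of the quotient by c = 1, and their gradings. -/

namespace ColorLieAlgebra

section General

variable {G R L : Type*} [AddCommGroup G] [DecidableEq G] [CommRing R] {ε : Bicharacter G R}
  [AddCommGroup L] [Module R L] (𝔤 : ColorLieAlgebra ε L)

theorem lift_ι : TensorAlgebra.lift R 𝔤.ι = 𝔤.mkU :=
  TensorAlgebra.hom_ext (LinearMap.ext fun x => by simp [ι])

theorem isTwistedEnveloping_ι : 𝔤.IsTwistedEnveloping 0 𝔤.ι where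
  surjective := by
    rw [lift_ι]
    exact RingCon.mkₐ_surjective _
  lift_eq_zero_iff t := by
    have h : 𝔤.relatorIdeal 0 = 𝔤.envelopingIdeal := by
      simp [relatorIdeal, envelopingIdeal, relator, lowerPart]
    rw [lift_ι, h, TwoSidedIdeal.mem_iff]
    exact RingCon.eq _

section Central

variable (ω : 𝔤.Z2)

/-- The quotient of the enveloping algebra of a central extension by `c = 1`. -/
abbrev TwistedU : Type _ :=
  (TwoSidedIdeal.span {1 - (𝔤.centralExtension ω).ι (0, 1)}).ringCon.Quotient

/-- The projection onto the quotient by `c = 1`. -/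
def mkTwistedU : (𝔤.centralExtension ω).U →ₐ[R] 𝔤.TwistedU ω := RingCon.mkₐ R _

/-- The canonical map from the color Lie algebra to its twisted enveloping algebra. -/
def ιTwistedU : L →ₗ[R] 𝔤.TwistedU ω :=
  (𝔤.mkTwistedU ω).toLinearMap ∘ₗ (𝔤.centralExtension ω).ι ∘ₗ LinearMap.inl R L R

theorem mkTwistedU_ι (x : L) (r : R) :
    𝔤.mkTwistedU ω ((𝔤.centralExtension ω).ι (x, r)) = 𝔤.ιTwistedU ω x + algebraMap R _ r := by
  have h1 : 𝔤.mkTwistedU ω ((𝔤.centralExtension ω).ι (0, 1)) = 1 := by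
    have := TwoSidedIdeal.subset_span (Set.mem_singleton
      (1 - (𝔤.centralExtension ω).ι (0, 1)))
    rw [SetLike.mem_coe, ← TwoSidedIdeal.rel_iff] at this
    have h : 𝔤.mkTwistedU ω 1 = 𝔤.mkTwistedU ω ((𝔤.centralExtension ω).ι (0, 1)) :=
      Quotient.sound this
    rw [← h, map_one]
  have h2 : ((x, r) : L × R) = (x, 0) + r • (0, 1) := by simp
  rw [h2, map_add, map_add, map_smul, map_smul, h1, Algebra.algebraMap_eq_smul_one]
  rfl

/-- The homomorphism of tensor algebras sending `x + r c` to `x + r`. -/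
def centralToTensor : TensorAlgebra R (L × R) →ₐ[R] TensorAlgebra R L :=
  TensorAlgebra.lift R (LinearMap.coprod (TensorAlgebra.ι R) (Algebra.linearMap R _))

variable {𝔤} in
theorem extGrading_snd_eq_zero {g : G} {p : L × R} (hp : p ∈ extGrading 𝔤.grading g)
    (hg : g ≠ 0) : p.2 = 0 := by
  simpa [hg] using hp.2

/-- The central components contribute nothing. They vanish outside degree 0, and a degree 0 argument
has sign 1, so constants commute past it and cancel. -/
theorem centralToTensor_relation {g h : G} {p q : L × R}
    (hp : p ∈ extGrading 𝔤.grading g) (hq : q ∈ extGrading 𝔤.grading h) :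
    centralToTensor (TensorAlgebra.ι R p * TensorAlgebra.ι R q
      - ε.val g h • (TensorAlgebra.ι R q * TensorAlgebra.ι R p)
      - TensorAlgebra.ι R ((𝔤.centralExtension ω).bracket p q)) =
      𝔤.relator ω g h p.1 q.1 := by
  obtain ⟨x, r⟩ := p
  obtain ⟨y, s⟩ := q
  simp only [centralToTensor, map_sub, map_mul, map_smul, TensorAlgebra.lift_ι_apply,
    LinearMap.coprod_apply, Algebra.linearMap_apply, centralExtension, LinearMap.mk₂_apply,
    relator, lowerPart]
  by_cases hgh : g = 0 ∨ h = 0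
  · have e : ε.val g h = 1 := by
      rcases hgh with rfl | rfl
      · exact ε.val_zero_left h
      · exact ε.val_zero_right g
    rw [e, one_smul, one_smul]
    simp only [add_mul, mul_add]
    rw [Algebra.commutes r (TensorAlgebra.ι R y), Algebra.commutes s (TensorAlgebra.ι R x),
      Algebra.commutes r (algebraMap R (TensorAlgebra R L) s)]
    abel
  · simp only [not_or] at hgh
    have hr : r = 0 := extGrading_snd_eq_zero hp hgh.1
    have hs : s = 0 := extGrading_snd_eq_zero hq hgh.2
    simp [hr, hs]

theorem lift_ιTwistedU_comp : (TensorAlgebra.lift R (𝔤.ιTwistedU ω)).comp centralToTensor =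
    (𝔤.mkTwistedU ω).comp (𝔤.centralExtension ω).mkU := by
  refine TensorAlgebra.hom_ext (LinearMap.ext ?_)
  rintro ⟨x, r⟩
  have := 𝔤.mkTwistedU_ι ω x r
  simp only [ι, LinearMap.comp_apply, AlgHom.toLinearMap_apply] at this
  simp [centralToTensor, this]

theorem mkTwistedU_comp_surjective :
    Function.Surjective ((𝔤.mkTwistedU ω).comp (𝔤.centralExtension ω).mkU) := by
  rw [AlgHom.coe_comp]
  exact (RingCon.mkₐ_surjective _).comp (RingCon.mkₐ_surjective _)

theorem lift_ιTwistedU_relator {g h : G} {x y : L} (hx : x ∈ 𝔤.grading g)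
    (hy : y ∈ 𝔤.grading h) :
    TensorAlgebra.lift R (𝔤.ιTwistedU ω) (𝔤.relator ω g h x y) = 0 := by
  have hp : ((x, 0) : L × R) ∈ extGrading 𝔤.grading g := ⟨hx, zero_mem _⟩
  have hq : ((y, 0) : L × R) ∈ extGrading 𝔤.grading h := ⟨hy, zero_mem _⟩
  rw [← 𝔤.centralToTensor_relation ω hp hq, ← AlgHom.comp_apply, lift_ιTwistedU_comp,
    AlgHom.comp_apply]
  have := (𝔤.centralExtension ω).ι_mul_ι hp hq
  rw [← sub_eq_zero] at this
  simp only [ι, LinearMap.comp_apply, AlgHom.toLinearMap_apply, ← map_mul, ← map_smul,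
    ← map_sub] at this
  rw [this, map_zero]

/-- The map from the twisted enveloping algebra to the quotient by the relators. -/
theorem exists_twistedU_to_quotient :
    ∃ F : 𝔤.TwistedU ω →ₐ[R] (𝔤.relatorIdeal ω).ringCon.Quotient,
      F.comp (TensorAlgebra.lift R (𝔤.ιTwistedU ω)) = RingCon.mkₐ R _ := by
  let p : TensorAlgebra R L →ₐ[R] (𝔤.relatorIdeal ω).ringCon.Quotient := RingCon.mkₐ R _
  have hp : ∀ t ∈ 𝔤.relatorIdeal ω, p t = 0 := fun t ht => Quotient.sound ht
  have h1 : (𝔤.centralExtension ω).envelopingIdeal ≤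
      TwoSidedIdeal.ker (p.comp centralToTensor).toRingHom := by
    refine TwoSidedIdeal.span_le.2 ?_
    rintro _ ⟨g, h, a, b, ha, hb, rfl⟩
    refine (TwoSidedIdeal.mem_ker _).2 (hp _ ?_)
    have := 𝔤.centralToTensor_relation ω ha hb
    simp only [RingHom.coe_coe]
    rw [this]
    exact TwoSidedIdeal.subset_span ⟨g, h, a.1, b.1, ha.1, hb.1, rfl⟩
  have h1' : (𝔤.centralExtension ω).envelopingIdeal.ringCon ≤
      RingCon.ker (p.comp centralToTensor).toRingHom := by
    intro x y hxy
    have h2 := (TwoSidedIdeal.mem_ker _).1 (h1 ((TwoSidedIdeal.rel_iff _ _ _).1 hxy))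
    rw [map_sub, sub_eq_zero] at h2
    exact h2
  let F1 : (𝔤.centralExtension ω).U →ₐ[R] (𝔤.relatorIdeal ω).ringCon.Quotient :=
    RingCon.liftₐ _ (p.comp centralToTensor) h1'
  have hF1 : ∀ t, F1 ((𝔤.centralExtension ω).mkU t) = p (centralToTensor t) := fun t => rfl
  have h2 : TwoSidedIdeal.span {1 - (𝔤.centralExtension ω).ι (0, 1)} ≤
      TwoSidedIdeal.ker F1.toRingHom := by
    refine TwoSidedIdeal.span_le.2 ?_
    rintro _ rfl
    refine (TwoSidedIdeal.mem_ker _).2 ?_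
    have : F1 ((𝔤.centralExtension ω).ι (0, 1)) = 1 := by
      refine (hF1 _).trans ?_
      simp [centralToTensor]
    simp [this]
  have h2' : (TwoSidedIdeal.span {1 - (𝔤.centralExtension ω).ι (0, 1)}).ringCon ≤
      RingCon.ker F1.toRingHom := by
    intro x y hxy
    have h3 := (TwoSidedIdeal.mem_ker _).1 (h2 ((TwoSidedIdeal.rel_iff _ _ _).1 hxy))
    rw [map_sub, sub_eq_zero] at h3
    exact h3
  refine ⟨RingCon.liftₐ _ F1 h2', TensorAlgebra.hom_ext (LinearMap.ext fun x => ?_)⟩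
  simp only [LinearMap.comp_apply, AlgHom.toLinearMap_apply, AlgHom.comp_apply,
    TensorAlgebra.lift_ι_apply]
  refine (hF1 (TensorAlgebra.ι R (x, 0))).trans ?_
  simp [centralToTensor, p]

/-- The substitution c ↦ 1 descends to a map from the quotient by c = 1 to the quotient by the
relators, which bounds the kernel from above. -/
theorem isTwistedEnveloping_ιTwistedU : 𝔤.IsTwistedEnveloping ω (𝔤.ιTwistedU ω) where
  surjective := by
    have := 𝔤.mkTwistedU_comp_surjective ω
    rw [← lift_ιTwistedU_comp, AlgHom.coe_comp] at this
    exact this.of_comp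
  lift_eq_zero_iff t := by
    constructor
    · intro ht
      obtain ⟨F, hF⟩ := 𝔤.exists_twistedU_to_quotient ω
      have := AlgHom.congr_fun hF t
      rw [AlgHom.comp_apply, ht, map_zero] at this
      exact (TwoSidedIdeal.mem_iff _ _).2 ((RingCon.eq _).1 this.symm)
    · intro ht
      have : 𝔤.relatorIdeal ω ≤
          TwoSidedIdeal.ker (TensorAlgebra.lift R (𝔤.ιTwistedU ω)).toRingHom := by
        refine TwoSidedIdeal.span_le.2 ?_
        rintro _ ⟨g, h, x, y, hx, hy, rfl⟩
        exact (TwoSidedIdeal.mem_ker _).2 (𝔤.lift_ιTwistedU_relator ω hx hy)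
      exact (TwoSidedIdeal.mem_ker _).1 (this ht)

/-- The grading of the twisted enveloping algebra. -/
def gradingTwistedU (g : G) : Submodule R (𝔤.TwistedU ω) :=
  ((𝔤.centralExtension ω).gradingU g).map (𝔤.mkTwistedU ω).toLinearMap

theorem mul_mem_gradingTwistedU {g h : G} {x y : 𝔤.TwistedU ω}
    (hx : x ∈ 𝔤.gradingTwistedU ω g) (hy : y ∈ 𝔤.gradingTwistedU ω h) :
    x * y ∈ 𝔤.gradingTwistedU ω (g + h) := by
  obtain ⟨u, hu, rfl⟩ := hx
  obtain ⟨v, hv, rfl⟩ := hy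
  exact ⟨u * v, SetLike.mul_mem_graded hu hv, map_mul (𝔤.mkTwistedU ω) u v⟩

theorem ιTwistedU_mem {g : G} {x : L} (hx : x ∈ 𝔤.grading g) :
    𝔤.ιTwistedU ω x ∈ 𝔤.gradingTwistedU ω g :=
  ⟨_, (𝔤.centralExtension ω).ι_mem (g := g) (a := (x, 0)) ⟨hx, zero_mem _⟩, rfl⟩

variable {I : Type*} {𝔤} (b : 𝔤.HomogeneousBasis I)

theorem HomogeneousBasis.gradingU_eq (g : G) : 𝔤.gradingU g = b.monomialSpan 𝔤.ι g := by
  refine le_antisymm ?_ (Submodule.span_le.2 ?_)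
  · rw [gradingU, Submodule.map_span_le]
    intro u hu
    induction hu with
    | one =>
      rw [AlgHom.toLinearMap_apply, map_one]
      exact b.one_mem_monomialSpan _
    | cons ha hu ih =>
      rw [AlgHom.toLinearMap_apply, map_mul]
      exact b.mul_mem_monomialSpan 𝔤.ι ha ih
  · rintro _ ⟨w, rfl, rfl⟩
    rw [HomogeneousBasis.monomial, lift_ι]
    exact ⟨_, Submodule.subset_span (b.isHomogeneousTensor_word w), rfl⟩

/-- The letter `c` has degree 0 and becomes a scalar, so dropping it from a homogeneous tensor does
not change the degree. With `gradingU_eq` this lets both gradings be compared on basis monomials. -/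
theorem HomogeneousBasis.gradingTwistedU_eq (g : G) :
    𝔤.gradingTwistedU ω g = b.monomialSpan (𝔤.ιTwistedU ω) g := by
  refine le_antisymm ?_ (Submodule.span_le.2 ?_)
  · rw [gradingTwistedU, gradingU, ← Submodule.map_comp, Submodule.map_span_le]
    intro u hu
    induction hu with
    | one =>
      rw [LinearMap.comp_apply, AlgHom.toLinearMap_apply, AlgHom.toLinearMap_apply, map_one,
        map_one]
      exact b.one_mem_monomialSpan _
    | @cons g h p u hp hu ih =>
      obtain ⟨x, r⟩ := p
      have h1 := 𝔤.mkTwistedU_ι ω x r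
      simp only [ι, LinearMap.comp_apply, AlgHom.toLinearMap_apply] at h1 ih
      rw [LinearMap.comp_apply, AlgHom.toLinearMap_apply, AlgHom.toLinearMap_apply, map_mul,
        map_mul, h1, add_mul]
      refine add_mem (b.mul_mem_monomialSpan _ hp.1 ih) ?_
      by_cases hg : g = 0
      · subst hg
        rw [zero_add, ← Algebra.smul_def]
        exact Submodule.smul_mem _ _ ih
      · have hr : r = 0 := extGrading_snd_eq_zero hp hg
        rw [hr, map_zero, zero_mul]
        exact zero_mem _
  · rintro _ ⟨w, rfl, rfl⟩
    induction w with
    | nil => exact ⟨1, SetLike.GradedOne.one_mem, 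
      (map_one (𝔤.mkTwistedU ω)).trans (b.monomial_nil _).symm⟩
    | cons i w ih =>
      rw [HomogeneousBasis.monomial_cons, HomogeneousBasis.wordDeg_cons]
      exact 𝔤.mul_mem_gradingTwistedU ω (𝔤.ιTwistedU_mem ω (b.mem_grading i)) ih

end Central

/-- Extension of scalars of a homogeneous basis. -/
def HomogeneousBasis.baseChange {I : Type*} {𝔤 : ColorLieAlgebra ε L}
    (b : 𝔤.HomogeneousBasis I) (S : Type*) [CommRing S] [Algebra R S] :
    (𝔤.baseChange S).HomogeneousBasis I where
  basis := b.basis.baseChange S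
  deg := b.deg
  odd := b.odd
  mem_grading i := by
    rw [Module.Basis.baseChange_apply]
    exact Submodule.tmul_mem_baseChange_of_mem _ (b.mem_grading i)
  grading_le g := by
    intro x hx
    induction hx using baseChange_induction with
    | h0 => exact zero_mem _
    | hadd x y _ _ hx hy => exact add_mem hx hy
    | ht s a ha =>
      have h := Submodule.tmul_mem_baseChange_of_mem s (b.grading_le g ha)
      rw [Submodule.baseChange_span] at h
      refine Submodule.span_mono ?_ h
      rintro _ ⟨_, ⟨i, hi, rfl⟩, rfl⟩
      exact ⟨i, hi, by simp⟩
  val_of_odd i hi := by rw [Bicharacter.map_val, b.val_of_odd i hi, map_neg, map_one]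
  val_of_not_odd i hi := by rw [Bicharacter.map_val, b.val_of_not_odd i hi, map_one]

end General

theorem exists_homogeneousBasis {G K L : Type*} [AddCommGroup G] [DecidableEq G] [Field K]
    {ε : Bicharacter G K} [AddCommGroup L] [Module K L] (𝔤 : ColorLieAlgebra ε L) :
    ∃ κ : ∀ g, Set (𝔤.grading g), Nonempty (𝔤.HomogeneousBasis (Σ g, κ g)) := by
  refine ⟨fun g => Module.Basis.ofVectorSpaceIndex K (𝔤.grading g), ⟨?_⟩⟩
  let v := fun g => Module.Basis.ofVectorSpace K (𝔤.grading g)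
  exact {
    basis := 𝔤.isInternal.collectedBasis v
    deg := Sigma.fst
    odd := fun i => ε.val i.1 i.1 = -1
    mem_grading := fun i => 𝔤.isInternal.collectedBasis_mem v i
    grading_le := by
      intro g x hx
      have := Submodule.mem_map_of_mem (f := (𝔤.grading g).subtype) ((v g).mem_span ⟨x, hx⟩)
      rw [Submodule.map_span] at this
      refine Submodule.span_mono ?_ this
      rintro _ ⟨_, ⟨i, rfl⟩, rfl⟩
      exact ⟨⟨g, i⟩, rfl, by simp⟩
    val_of_odd := fun i hi => hi
    -- Over a field ε(g,g)² = 1 leaves only ±1. `HomogeneousBasis` records this dichotomy so that it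
    -- survives base change.
    val_of_not_odd := fun i hi => (mul_self_eq_one_iff.1 (ε.val_mul_val i.1 i.1)).resolve_right hi }

end ColorLieAlgebra

/-! ### From K[[t]] ⊗ A to A[[t]]. -/

section Series

variable {K A : Type*} [Field K] [Ring A] [Algebra K A]

/-- The coefficient of `tⁿ`, as a linear map on `K[[t]] ⊗ A`. -/
def tensorCoeff (n : ℕ) : K⟦X⟧ ⊗[K] A →ₗ[K] A :=
  TensorProduct.lift (LinearMap.lsmul K A ∘ₗ (PowerSeries.coeff n : K⟦X⟧ →ₗ[K] K))

theorem coeff_tensorToSeries (n : ℕ) (x : K⟦X⟧ ⊗[K] A) :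
    PowerSeries.coeff n (tensorToSeries x) = tensorCoeff n x := by
  rw [tensorToSeries, PowerSeries.coeff_mk]
  rfl

@[simp]
theorem tensorCoeff_tmul (n : ℕ) (s : K⟦X⟧) (a : A) :
    tensorCoeff n (s ⊗ₜ[K] a) = PowerSeries.coeff n s • a := rfl

theorem tensorCoeff_smul (n : ℕ) (s : K⟦X⟧) (x : K⟦X⟧ ⊗[K] A) :
    tensorCoeff n (s • x) = ∑ p ∈ Finset.HasAntidiagonal.antidiagonal n,
      PowerSeries.coeff p.1 s • tensorCoeff p.2 x := by
  induction x with
  | zero => simp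
  | add x y hx hy => simp only [smul_add, map_add, hx, hy, Finset.sum_add_distrib]
  | tmul r a =>
    rw [TensorProduct.smul_tmul', tensorCoeff_tmul, smul_eq_mul, PowerSeries.coeff_mul,
      Finset.sum_smul]
    simp [mul_smul]

theorem coeff_starProduct (π : ℕ → A →ₗ[K] A →ₗ[K] A) (a b : A⟦X⟧) (n : ℕ) :
    PowerSeries.coeff n (starProduct π a b) =
      ∑ p ∈ Finset.HasAntidiagonal.antidiagonal n,
        ∑ q ∈ Finset.HasAntidiagonal.antidiagonal p.2,
          π p.1 (PowerSeries.coeff q.1 a) (PowerSeries.coeff q.2 b) :=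
  PowerSeries.coeff_mk _ _

theorem starProduct_add_left (π : ℕ → A →ₗ[K] A →ₗ[K] A) (a a' b : A⟦X⟧) :
    starProduct π (a + a') b = starProduct π a b + starProduct π a' b := by
  ext n
  simp only [map_add, coeff_starProduct, LinearMap.add_apply, Finset.sum_add_distrib]

theorem starProduct_add_right (π : ℕ → A →ₗ[K] A →ₗ[K] A) (a b b' : A⟦X⟧) :
    starProduct π a (b + b') = starProduct π a b + starProduct π a b' := by
  ext n
  simp only [map_add, coeff_starProduct, Finset.sum_add_distrib]

/-- The t-adic continuity of the star product. -/
theorem coeff_starProduct_congr (π : ℕ → A →ₗ[K] A →ₗ[K] A) {a a' b b' : A⟦X⟧} {n : ℕ}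
    (ha : ∀ i ≤ n, PowerSeries.coeff i a = PowerSeries.coeff i a')
    (hb : ∀ i ≤ n, PowerSeries.coeff i b = PowerSeries.coeff i b') :
    ∀ i ≤ n, PowerSeries.coeff i (starProduct π a b) =
      PowerSeries.coeff i (starProduct π a' b') := by
  intro i hi
  rw [coeff_starProduct, coeff_starProduct]
  refine Finset.sum_congr rfl fun p hp => Finset.sum_congr rfl fun q hq => ?_
  rw [Finset.HasAntidiagonal.mem_antidiagonal] at hp hq
  rw [ha q.1 (by omega), hb q.2 (by omega)]

theorem tensorToSeries_add (x y : K⟦X⟧ ⊗[K] A) :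
    tensorToSeries (x + y) = tensorToSeries x + tensorToSeries y := by
  ext n
  simp only [map_add, coeff_tensorToSeries]

theorem tensorToSeries_zero : tensorToSeries (0 : K⟦X⟧ ⊗[K] A) = 0 := by
  ext n
  simp only [map_zero, coeff_tensorToSeries]

/-- A `K[[t]]`-bilinear product on `K[[t]] ⊗ A` corresponds to the product on `A[[t]]` given by
its coefficients. -/
theorem tensorToSeries_bilinear {π : ℕ → A →ₗ[K] A →ₗ[K] A}
    (m : (K⟦X⟧ ⊗[K] A) →ₗ[K⟦X⟧] (K⟦X⟧ ⊗[K] A) →ₗ[K⟦X⟧] (K⟦X⟧ ⊗[K] A))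
    (hm : ∀ u v : A, tensorToSeries (m (1 ⊗ₜ[K] u) (1 ⊗ₜ[K] v)) =
      PowerSeries.mk fun n => π n u v) (x y : K⟦X⟧ ⊗[K] A) :
    tensorToSeries (m x y) = starProduct π (tensorToSeries x) (tensorToSeries y) := by
  induction x with
  | zero =>
    have h := starProduct_add_left π 0 0 (tensorToSeries y)
    rw [add_zero, left_eq_add] at h
    rw [map_zero, LinearMap.zero_apply, tensorToSeries_zero, h]
  | add x x' hx hx' =>
    rw [map_add, LinearMap.add_apply, tensorToSeries_add, tensorToSeries_add, hx, hx',
      starProduct_add_left]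
  | tmul s u =>
    induction y with
    | zero =>
      have h := starProduct_add_right π (tensorToSeries (s ⊗ₜ[K] u)) 0 0
      rw [add_zero, left_eq_add] at h
      rw [map_zero, tensorToSeries_zero, h]
    | add y y' hy hy' =>
      rw [map_add, tensorToSeries_add, tensorToSeries_add, hy, hy', starProduct_add_right]
    | tmul t v =>
      have e1 : s ⊗ₜ[K] u = s • ((1 : K⟦X⟧) ⊗ₜ[K] u) := by
        rw [TensorProduct.smul_tmul', smul_eq_mul, mul_one]
      have e2 : t ⊗ₜ[K] v = t • ((1 : K⟦X⟧) ⊗ₜ[K] v) := by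
        rw [TensorProduct.smul_tmul', smul_eq_mul, mul_one]
      have e3 : m (s ⊗ₜ[K] u) (t ⊗ₜ[K] v) =
          (s * t) • m ((1 : K⟦X⟧) ⊗ₜ[K] u) ((1 : K⟦X⟧) ⊗ₜ[K] v) := by
        rw [e1, e2, map_smul, map_smul, LinearMap.smul_apply, smul_smul, mul_comm]
      ext n
      rw [e3, coeff_tensorToSeries, tensorCoeff_smul, coeff_starProduct,
        ← Finset.Nat.sum_antidiagonal_swap]
      refine Finset.sum_congr rfl fun p _ => ?_
      have h := congrArg (PowerSeries.coeff p.1) (hm u v)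
      rw [coeff_tensorToSeries, PowerSeries.coeff_mk] at h
      simp only [Prod.fst_swap, Prod.snd_swap, h, PowerSeries.coeff_mul, Finset.sum_smul]
      refine Finset.sum_congr rfl fun q _ => ?_
      simp only [coeff_tensorToSeries, tensorCoeff_tmul, map_smul, LinearMap.smul_apply]
      rw [smul_smul, mul_comm]

/-- The map from K[[t]] ⊗ A to A[[t]] need not be surjective when A is infinite-dimensional, but its
image is t-adically dense. By continuity that is enough to transfer associativity. -/
theorem exists_tensorToSeries_approx (a : A⟦X⟧) (n : ℕ) : ∃ x : K⟦X⟧ ⊗[K] A,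
    ∀ i ≤ n, PowerSeries.coeff i a = PowerSeries.coeff i (tensorToSeries x) := by
  refine ⟨∑ j ∈ Finset.range (n + 1), (PowerSeries.X ^ j : K⟦X⟧) ⊗ₜ[K] PowerSeries.coeff j a,
    fun i hi => ?_⟩
  simp only [coeff_tensorToSeries, map_sum, tensorCoeff_tmul, PowerSeries.coeff_X_pow, ite_smul,
    one_smul, zero_smul]
  rw [Finset.sum_ite_eq, if_pos (Finset.mem_range.2 (by omega))]

/-- An associative `K[[t]]`-bilinear product on `K[[t]] ⊗ A` gives an associative product on
`A[[t]]`. -/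
theorem starProduct_assoc {π : ℕ → A →ₗ[K] A →ₗ[K] A}
    (m : (K⟦X⟧ ⊗[K] A) →ₗ[K⟦X⟧] (K⟦X⟧ ⊗[K] A) →ₗ[K⟦X⟧] (K⟦X⟧ ⊗[K] A))
    (hm : ∀ u v : A, tensorToSeries (m (1 ⊗ₜ[K] u) (1 ⊗ₜ[K] v)) =
      PowerSeries.mk fun n => π n u v)
    (hassoc : ∀ x y z, m (m x y) z = m x (m y z)) (a b c : A⟦X⟧) :
    starProduct π (starProduct π a b) c = starProduct π a (starProduct π b c) := by
  ext n
  obtain ⟨x, hx⟩ := exists_tensorToSeries_approx (K := K) a n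
  obtain ⟨y, hy⟩ := exists_tensorToSeries_approx (K := K) b n
  obtain ⟨z, hz⟩ := exists_tensorToSeries_approx (K := K) c n
  rw [coeff_starProduct_congr π (coeff_starProduct_congr π hx hy) hz n le_rfl,
    coeff_starProduct_congr π hx (coeff_starProduct_congr π hy hz) n le_rfl,
    ← tensorToSeries_bilinear m hm, ← tensorToSeries_bilinear m hm,
    ← tensorToSeries_bilinear m hm, ← tensorToSeries_bilinear m hm, hassoc]

/-- An element of `K[[t]] ⊗ A` differs from its constant coefficient by a multiple of `t`. -/
theorem exists_eq_tmul_tensorCoeff_add (x : K⟦X⟧ ⊗[K] A) :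
    ∃ y, x = 1 ⊗ₜ[K] tensorCoeff 0 x + (PowerSeries.X : K⟦X⟧) • y := by
  induction x with
  | zero => exact ⟨0, by simp⟩
  | add x x' hx hx' =>
    obtain ⟨y, hy⟩ := hx
    obtain ⟨y', hy'⟩ := hx'
    refine ⟨y + y', ?_⟩
    rw [map_add, TensorProduct.tmul_add, smul_add]
    nth_rw 1 [hy, hy']
    abel
  | tmul s a =>
    obtain ⟨r, hr⟩ : (PowerSeries.X : K⟦X⟧) ∣ s - PowerSeries.C (PowerSeries.coeff 0 s) := by
      rw [PowerSeries.X_dvd_iff]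
      simp
    refine ⟨r ⊗ₜ[K] a, ?_⟩
    rw [tensorCoeff_tmul, TensorProduct.tmul_smul, TensorProduct.smul_tmul',
      TensorProduct.smul_tmul', ← TensorProduct.add_tmul, smul_eq_mul, ← hr,
      PowerSeries.smul_eq_C_mul, mul_one, add_sub_cancel]

end Series

/-! ### Universal property, the deformed relations and specialization at t = 0. -/

namespace ColorLieAlgebra

theorem IsTwistedEnveloping.exists_lift {G R L : Type*} [AddCommGroup G] [DecidableEq G]
    [CommRing R] {ε : Bicharacter G R} [AddCommGroup L] [Module R L] {𝔤 : ColorLieAlgebra ε L}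
    {ω : 𝔤.Z2} {A : Type*} [Ring A] [Algebra R A] {f : L →ₗ[R] A}
    (hf : 𝔤.IsTwistedEnveloping ω f) {B : Type*} [Ring B] [Algebra R B] (h : L →ₗ[R] B)
    (hrel : ∀ g k x y, x ∈ 𝔤.grading g → y ∈ 𝔤.grading k →
      h x * h y - ε.val g k • (h y * h x) = h (𝔤.bracket x y) + algebraMap R B (ω.1 x y)) :
    ∃ F : A →ₐ[R] B, ∀ x, F (f x) = h x := by
  have hker : RingHom.ker (TensorAlgebra.lift R f : TensorAlgebra R L →+* A) ≤
      RingHom.ker (TensorAlgebra.lift R h : TensorAlgebra R L →+* B) := by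
    intro t ht
    have ht' := (hf.lift_eq_zero_iff t).1 ht
    have : 𝔤.relatorIdeal ω ≤ TwoSidedIdeal.ker (TensorAlgebra.lift R h).toRingHom := by
      refine TwoSidedIdeal.span_le.2 ?_
      rintro _ ⟨g, k, x, y, hx, hy, rfl⟩
      refine (TwoSidedIdeal.mem_ker _).2 ?_
      simp [relator, lowerPart, hrel g k x y hx hy]
    exact (TwoSidedIdeal.mem_ker _).1 (this ht')
  let F := RingHom.liftOfSurjective (TensorAlgebra.lift R f : TensorAlgebra R L →+* A)
    hf.surjective ⟨_, hker⟩
  have hF : ∀ t, F (TensorAlgebra.lift R f t) = TensorAlgebra.lift R h t :=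
    RingHom.liftOfSurjective_comp_apply _ hf.surjective ⟨_, hker⟩
  refine ⟨{ F with commutes' := fun r => ?_ }, fun x => ?_⟩
  · have := hF (algebraMap R _ r)
    simpa using this
  · have := hF (TensorAlgebra.ι R x)
    simpa using this

variable {G K L : Type*} [AddCommGroup G] [DecidableEq G] [Field K] {ε : Bicharacter G K}
  [AddCommGroup L] [Module K L] (𝔤 : ColorLieAlgebra ε L)

/-- The zero map satisfies the defining relations because the cocycle is 0. -/
theorem exists_augmentation : ∃ a : 𝔤.U →ₐ[K] K, ∀ x, a (𝔤.ι x) = 0 :=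
  𝔤.isTwistedEnveloping_ι.exists_lift 0 (by simp)

variable (ω : 𝔤.Z2)

/-- The canonical `K[[t]]`-linear map `K[[t]] ⊗ 𝔤 → U_{tω}(𝔤)`. -/
def ιUTLinear : (K⟦X⟧ ⊗[K] L) →ₗ[K⟦X⟧] 𝔤.UT ω :=
  (𝔤.baseChange K⟦X⟧).ιTwistedU ((PowerSeries.X : K⟦X⟧) • 𝔤.baseChangeCocycle K⟦X⟧ ω)

theorem ιUTLinear_tmul (s : K⟦X⟧) (x : L) : 𝔤.ιUTLinear ω (s ⊗ₜ[K] x) = s • 𝔤.ιUT ω x := by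
  rw [← mul_one s, ← smul_eq_mul, ← TensorProduct.smul_tmul', map_smul]
  simp only [smul_eq_mul, mul_one]
  rfl

/-- By definition `UT` is the twisted enveloping algebra of the base change for the cocycle tω, so
the general results apply over `K⟦X⟧`. -/
theorem isTwistedEnveloping_ιUTLinear : (𝔤.baseChange K⟦X⟧).IsTwistedEnveloping
    ((PowerSeries.X : K⟦X⟧) • 𝔤.baseChangeCocycle K⟦X⟧ ω) (𝔤.ιUTLinear ω) :=
  (𝔤.baseChange K⟦X⟧).isTwistedEnveloping_ιTwistedU _

theorem mul_mem_gradingUT {g h : G} {x y : 𝔤.UT ω} (hx : x ∈ 𝔤.gradingUT ω g)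
    (hy : y ∈ 𝔤.gradingUT ω h) : x * y ∈ 𝔤.gradingUT ω (g + h) :=
  (𝔤.baseChange K⟦X⟧).mul_mem_gradingTwistedU _ hx hy

theorem gradingUT_eq {𝔤 : ColorLieAlgebra ε L} {I : Type*} (b : 𝔤.HomogeneousBasis I)
    (ω : 𝔤.Z2) (g : G) :
    𝔤.gradingUT ω g = (b.baseChange K⟦X⟧).monomialSpan (𝔤.ιUTLinear ω) g :=
  (b.baseChange K⟦X⟧).gradingTwistedU_eq _ g

theorem ιUT_mem {g : G} {x : L} (hx : x ∈ 𝔤.grading g) : 𝔤.ιUT ω x ∈ 𝔤.gradingUT ω g :=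
  (𝔤.baseChange K⟦X⟧).ιTwistedU_mem _ (Submodule.tmul_mem_baseChange_of_mem 1 hx)

theorem ιUT_relation {g h : G} {x y : L} (hx : x ∈ 𝔤.grading g) (hy : y ∈ 𝔤.grading h) :
    𝔤.ιUT ω x * 𝔤.ιUT ω y - PowerSeries.C (ε.val g h) • (𝔤.ιUT ω y * 𝔤.ιUT ω x) =
      𝔤.ιUT ω (𝔤.bracket x y) + (PowerSeries.X * PowerSeries.C (ω.1 x y) : K⟦X⟧) • 1 := by
  have h1 := HomogeneousBasis.lift_relator _ (𝔤.isTwistedEnveloping_ιUTLinear ω)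
    (Submodule.tmul_mem_baseChange_of_mem (1 : K⟦X⟧) hx)
    (Submodule.tmul_mem_baseChange_of_mem (1 : K⟦X⟧) hy)
  simp only [relator, lowerPart, map_sub, map_mul, map_add, map_smul,
    TensorAlgebra.lift_ι_apply, AlgHom.commutes, ιUTLinear_tmul, one_smul] at h1
  rw [sub_eq_zero] at h1
  refine h1.trans ?_
  congr 1
  · have : (𝔤.baseChange K⟦X⟧).bracket (1 ⊗ₜ[K] x) (1 ⊗ₜ[K] y) = 1 ⊗ₜ[K] 𝔤.bracket x y := by
      simp [baseChange]
    rw [this, ιUTLinear_tmul, one_smul]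
  · rw [Algebra.algebraMap_eq_smul_one]
    congr 1
    simp [baseChangeCocycle, Algebra.smul_def]

/-- Specialization at `t = 0`. -/
theorem exists_specialization : ∃ q : 𝔤.UT ω →+* 𝔤.U, (∀ x, q (𝔤.ιUT ω x) = 𝔤.ι x) ∧
    ∀ (s : K⟦X⟧) z, q (s • z) = PowerSeries.constantCoeff s • q z := by
  -- `U` becomes a `K⟦X⟧`-algebra on which t acts by zero. The cocycle tω then maps to 0, and the
  -- undeformed relations are the required ones.
  let j : K⟦X⟧ →+* 𝔤.U := (algebraMap K 𝔤.U).comp PowerSeries.constantCoeff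
  let : Algebra K⟦X⟧ 𝔤.U := j.toAlgebra' fun c x =>
    Algebra.commutes (R := K) (PowerSeries.constantCoeff c) x
  have hs : ∀ (s : K⟦X⟧) (z : 𝔤.U), s • z = PowerSeries.constantCoeff s • z := fun s z => by
    rw [Algebra.smul_def (PowerSeries.constantCoeff s)]
    rfl
  have : IsScalarTower K K⟦X⟧ 𝔤.U := ⟨fun r s z => by
    rw [hs, hs, smul_smul, PowerSeries.smul_eq_C_mul, map_mul, PowerSeries.constantCoeff_C]⟩
  have ht : ∀ (s : K⟦X⟧) x, LinearMap.liftBaseChange K⟦X⟧ 𝔤.ι (s ⊗ₜ[K] x) =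
      PowerSeries.constantCoeff s • 𝔤.ι x := fun s x => by
    rw [LinearMap.liftBaseChange_tmul, hs]
  obtain ⟨F, hF⟩ := (𝔤.isTwistedEnveloping_ιUTLinear ω).exists_lift
    (LinearMap.liftBaseChange K⟦X⟧ 𝔤.ι) (fun g k x y hx hy => by
      have h0 : algebraMap K⟦X⟧ 𝔤.U (((PowerSeries.X : K⟦X⟧) •
          𝔤.baseChangeCocycle K⟦X⟧ ω).1 x y) = 0 := by
        rw [Submodule.coe_smul, LinearMap.smul_apply, LinearMap.smul_apply, smul_eq_mul, map_mul]
        have : algebraMap K⟦X⟧ 𝔤.U PowerSeries.X = 0 := by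
          change algebraMap K 𝔤.U (PowerSeries.constantCoeff PowerSeries.X) = 0
          rw [PowerSeries.constantCoeff_X, map_zero]
        rw [this, zero_mul]
      rw [h0, add_zero, Bicharacter.map_val, hs, PowerSeries.algebraMap_apply,
        Algebra.algebraMap_self_apply, PowerSeries.constantCoeff_C]
      clear h0
      induction hx using baseChange_induction with
      | h0 => simp
      | hadd x x' _ _ hx hx' =>
        have := congrArg₂ (· + ·) hx hx'
        simp only [map_add, LinearMap.add_apply, add_mul, mul_add, smul_add] at this ⊢
        rw [← this]
        abel
      | ht s x hx =>
        induction hy using baseChange_induction with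
        | h0 => simp
        | hadd y y' _ _ hy hy' =>
          have := congrArg₂ (· + ·) hy hy'
          simp only [map_add, add_mul, mul_add, smul_add] at this ⊢
          rw [← this]
          abel
        | ht r y hy =>
          simp only [baseChange, LinearMap.BilinMap.baseChange_tmul, ht]
          rw [← 𝔤.ι_mul_ι hx hy]
          simp only [map_mul, smul_mul_assoc, mul_smul_comm]
          module)
  refine ⟨F.toRingHom, fun x => ?_, fun s z => ?_⟩
  · have := hF (1 ⊗ₜ[K] x)
    rw [ιUTLinear_tmul, one_smul, ht, map_one, one_smul] at this
    exact this
  · refine (map_smul F s z).trans (hs _ _)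

end ColorLieAlgebra

namespace ColorLieAlgebra

variable {G K L : Type*} [AddCommGroup G] [DecidableEq G] [Field K] {ε : Bicharacter G K}
  [AddCommGroup L] [Module K L] (𝔤 : ColorLieAlgebra ε L)

theorem tensorCoeff_mem_of_mem_baseChange {A : Type*} [Ring A] [Algebra K A] {p : Submodule K A}
    {x : K⟦X⟧ ⊗[K] A} (hx : x ∈ p.baseChange K⟦X⟧) (n : ℕ) : tensorCoeff n x ∈ p := by
  induction hx using baseChange_induction with
  | h0 => rw [map_zero]; exact zero_mem _
  | hadd x y _ _ hx hy => rw [map_add]; exact add_mem hx hy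
  | ht s a ha => exact Submodule.smul_mem _ _ ha

/-! ### The isomorphism Φ. -/

section PBW

variable [CharZero K] {𝔤} {I : Type*} [LinearOrder I] (b : 𝔤.HomogeneousBasis I) (ω : 𝔤.Z2)

/-- The Poincaré–Birkhoff–Witt basis of the enveloping algebra. -/
def HomogeneousBasis.basisU : Module.Basis b.NormalWord K 𝔤.U :=
  b.pbwBasis 0 𝔤.isTwistedEnveloping_ι

/-- The Poincaré–Birkhoff–Witt basis of the deformed enveloping algebra. -/
def HomogeneousBasis.basisUT : Module.Basis b.NormalWord K⟦X⟧ (𝔤.UT ω) :=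
  -- Base change keeps letters, order and parities, so its normal words are literally those of `b`.
  (b.baseChange K⟦X⟧).pbwBasis _ (𝔤.isTwistedEnveloping_ιUTLinear ω)

theorem HomogeneousBasis.basisU_apply (w : b.NormalWord) :
    b.basisU w = b.monomial 𝔤.ι w.1 :=
  b.pbwBasis_apply 0 𝔤.isTwistedEnveloping_ι w

theorem HomogeneousBasis.basisUT_apply (w : b.NormalWord) :
    b.basisUT ω w = (b.baseChange K⟦X⟧).monomial (𝔤.ιUTLinear ω) w.1 :=
  (b.baseChange K⟦X⟧).pbwBasis_apply _ (𝔤.isTwistedEnveloping_ιUTLinear ω) w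

/-- The isomorphism matching the two Poincaré–Birkhoff–Witt bases. -/
def HomogeneousBasis.pbwEquiv : (K⟦X⟧ ⊗[K] 𝔤.U) ≃ₗ[K⟦X⟧] 𝔤.UT ω :=
  (b.basisU.baseChange K⟦X⟧).equiv (b.basisUT ω) (Equiv.refl _)

theorem HomogeneousBasis.pbwEquiv_basisU (w : b.NormalWord) :
    b.pbwEquiv ω (1 ⊗ₜ[K] b.basisU w) = b.basisUT ω w := by
  rw [← Module.Basis.baseChange_apply, pbwEquiv, Module.Basis.equiv_apply, Equiv.refl_apply]

theorem HomogeneousBasis.pbwEquiv_one : b.pbwEquiv ω (1 ⊗ₜ[K] 1) = 1 := by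
  have h : b.IsNormal [] := fun u i j v e => by simp at e
  have := b.pbwEquiv_basisU ω ⟨[], h⟩
  rwa [basisU_apply, basisUT_apply, monomial_nil, monomial_nil] at this

theorem HomogeneousBasis.pbwEquiv_ι (x : L) :
    b.pbwEquiv ω (1 ⊗ₜ[K] 𝔤.ι x) = 𝔤.ιUT ω x := by
  have h : (b.pbwEquiv ω).toLinearMap ∘ₗ 𝔤.ι.baseChange K⟦X⟧ = 𝔤.ιUTLinear ω := by
    refine (b.basis.baseChange K⟦X⟧).ext fun i => ?_
    have hi : b.IsNormal [i] := fun u i' j v e => by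
      have := congrArg List.length e
      simp only [List.length_cons, List.length_append, List.length_nil] at this
      omega
    have := b.pbwEquiv_basisU ω ⟨[i], hi⟩
    rw [basisU_apply, basisUT_apply, monomial_cons, monomial_cons, monomial_nil, monomial_nil,
      mul_one, mul_one] at this
    rw [Module.Basis.baseChange_apply, LinearMap.comp_apply, LinearMap.baseChange_tmul]
    refine this.trans ?_
    simp [baseChange]
  have := LinearMap.congr_fun h (1 ⊗ₜ[K] x)
  rw [ιUTLinear_tmul, one_smul] at this
  simpa using this

theorem HomogeneousBasis.isGradedEquiv_pbwEquiv : 𝔤.IsGradedEquiv (b.pbwEquiv ω) := by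
  intro g
  have h := (b.baseChange K⟦X⟧).monomialSpan_eq _ (𝔤.isTwistedEnveloping_ιUTLinear ω) g
  rw [gradingUT_eq b, b.gradingU_eq, b.monomialSpan_eq 0 𝔤.isTwistedEnveloping_ι,
    Submodule.baseChange_span, Submodule.map_span, ← Set.image_comp, ← Set.image_comp, h]
  congr 1
  refine Set.image_congr fun w _ => ?_
  exact b.pbwEquiv_basisU ω w

/-- Specialization carries each basis monomial of `UT` to the monomial of `U` with the same word.
Since `q` is multiplicative, the transported product has the product of `U` as its constant term. -/
theorem HomogeneousBasis.specialization_pbwEquiv {q : 𝔤.UT ω →+* 𝔤.U}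
    (hq : ∀ x, q (𝔤.ιUT ω x) = 𝔤.ι x)
    (hs : ∀ (s : K⟦X⟧) z, q (s • z) = PowerSeries.constantCoeff s • q z)
    (x : K⟦X⟧ ⊗[K] 𝔤.U) : q (b.pbwEquiv ω x) = tensorCoeff 0 x := by
  have hm : ∀ w, q ((b.baseChange K⟦X⟧).monomial (𝔤.ιUTLinear ω) w) = b.monomial 𝔤.ι w := by
    intro w
    induction w with
    | nil => rw [monomial_nil, monomial_nil, map_one]
    | cons i w ih =>
      have e : (b.baseChange K⟦X⟧).basis i = 1 ⊗ₜ[K] b.basis i := by simp [baseChange]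
      rw [monomial_cons, monomial_cons, map_mul, ih, e, ιUTLinear_tmul, one_smul, hq]
  have h1 : ∀ u, q (b.pbwEquiv ω (1 ⊗ₜ[K] u)) = u := by
    intro u
    have hu := b.basisU.mem_span u
    induction hu using Submodule.span_induction with
    | mem u hu =>
      obtain ⟨w, rfl⟩ := hu
      rw [pbwEquiv_basisU, basisUT_apply, basisU_apply, hm]
    | zero => simp
    | add u v _ _ hu hv => rw [TensorProduct.tmul_add, map_add, map_add, hu, hv]
    | smul r u _ hu =>
      have e : (1 : K⟦X⟧) ⊗ₜ[K] (r • u) = PowerSeries.C r • ((1 : K⟦X⟧) ⊗ₜ[K] u) := by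
        rw [TensorProduct.tmul_smul, TensorProduct.smul_tmul', TensorProduct.smul_tmul',
          PowerSeries.smul_eq_C_mul, smul_eq_mul]
      rw [e, map_smul, hs, hu, PowerSeries.constantCoeff_C]
  induction x with
  | zero => simp
  | add x y hx hy => rw [map_add, map_add, map_add, hx, hy]
  | tmul s u =>
    have e : s ⊗ₜ[K] u = s • ((1 : K⟦X⟧) ⊗ₜ[K] u) := by
      rw [TensorProduct.smul_tmul', smul_eq_mul, mul_one]
    rw [e, map_smul, hs, h1, ← e, tensorCoeff_tmul, PowerSeries.coeff_zero_eq_constantCoeff]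

end PBW

/-! ### The deformation induced by a graded isomorphism. -/

section Induced

variable {𝔤} {ω : 𝔤.Z2} (Φ : (K⟦X⟧ ⊗[K] 𝔤.U) ≃ₗ[K⟦X⟧] 𝔤.UT ω)

/-- The product of `U_{tω}(𝔤)` transported to `K[[t]] ⊗ U(𝔤)`. -/
def transportedProduct : (K⟦X⟧ ⊗[K] 𝔤.U) →ₗ[K⟦X⟧] (K⟦X⟧ ⊗[K] 𝔤.U) →ₗ[K⟦X⟧] (K⟦X⟧ ⊗[K] 𝔤.U) :=
  ((LinearMap.mul K⟦X⟧ (𝔤.UT ω)).compl₁₂ Φ.toLinearMap Φ.toLinearMap).compr₂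
    Φ.symm.toLinearMap

theorem transportedProduct_apply (x y : K⟦X⟧ ⊗[K] 𝔤.U) :
    transportedProduct Φ x y = Φ.symm (Φ x * Φ y) := rfl

theorem transportedProduct_assoc (x y z : K⟦X⟧ ⊗[K] 𝔤.U) :
    transportedProduct Φ (transportedProduct Φ x y) z =
      transportedProduct Φ x (transportedProduct Φ y z) := by
  simp only [transportedProduct_apply, LinearEquiv.apply_symm_apply, mul_assoc]

/-- The coefficients of the product of `U_{tω}(𝔤)`. -/
def productCoeff (n : ℕ) : 𝔤.U →ₗ[K] 𝔤.U →ₗ[K] 𝔤.U :=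
  LinearMap.mk₂ K (fun u v => tensorCoeff n (transportedProduct Φ (1 ⊗ₜ[K] u) (1 ⊗ₜ[K] v)))
    (fun u u' v => by rw [TensorProduct.tmul_add, map_add, LinearMap.add_apply, map_add])
    (fun r u v => by
      rw [TensorProduct.tmul_smul, LinearMap.map_smul_of_tower, LinearMap.smul_apply, map_smul])
    (fun u v v' => by rw [TensorProduct.tmul_add, map_add, map_add])
    (fun r u v => by
      rw [TensorProduct.tmul_smul, LinearMap.map_smul_of_tower, map_smul])

theorem tensorToSeries_transportedProduct (u v : 𝔤.U) :
    tensorToSeries (transportedProduct Φ (1 ⊗ₜ[K] u) (1 ⊗ₜ[K] v)) =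
      PowerSeries.mk fun n => productCoeff Φ n u v := by
  ext n
  rw [coeff_tensorToSeries, PowerSeries.coeff_mk]
  rfl

theorem IsGradedEquiv.apply_mem {Φ : (K⟦X⟧ ⊗[K] 𝔤.U) ≃ₗ[K⟦X⟧] 𝔤.UT ω}
    (hΦ : 𝔤.IsGradedEquiv Φ) {g : G} {u : 𝔤.U} (hu : u ∈ 𝔤.gradingU g) :
    Φ (1 ⊗ₜ[K] u) ∈ 𝔤.gradingUT ω g := by
  rw [← hΦ g]
  exact ⟨_, Submodule.tmul_mem_baseChange_of_mem 1 hu, rfl⟩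

theorem IsGradedEquiv.symm_apply_mem {Φ : (K⟦X⟧ ⊗[K] 𝔤.U) ≃ₗ[K⟦X⟧] 𝔤.UT ω}
    (hΦ : 𝔤.IsGradedEquiv Φ) {g : G} {z : 𝔤.UT ω} (hz : z ∈ 𝔤.gradingUT ω g) :
    Φ.symm z ∈ (𝔤.gradingU g).baseChange K⟦X⟧ := by
  rw [← hΦ g] at hz
  obtain ⟨x, hx, rfl⟩ := hz
  simpa using hx

/-- The graded deformation induced by a graded isomorphism that is multiplicative at `t = 0`. -/
def inducedDeformation (hΦ : 𝔤.IsGradedEquiv Φ)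
    (h0 : ∀ u v, tensorCoeff 0 (Φ.symm (Φ (1 ⊗ₜ[K] u) * Φ (1 ⊗ₜ[K] v))) = u * v) :
    GradedDeformation 𝔤.gradingU where
  π := productCoeff Φ
  π_zero := LinearMap.ext fun u => LinearMap.ext fun v => h0 u v
  degree n _ _ _ _ hu hv := tensorCoeff_mem_of_mem_baseChange
    (hΦ.symm_apply_mem (𝔤.mul_mem_gradingUT ω (hΦ.apply_mem hu) (hΦ.apply_mem hv))) n
  assoc := starProduct_assoc (transportedProduct Φ) (tensorToSeries_transportedProduct Φ)
    (transportedProduct_assoc Φ)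

theorem isInducedBy_inducedDeformation (hΦ : 𝔤.IsGradedEquiv Φ)
    (h0 : ∀ u v, tensorCoeff 0 (Φ.symm (Φ (1 ⊗ₜ[K] u) * Φ (1 ⊗ₜ[K] v))) = u * v) :
    𝔤.IsInducedBy (inducedDeformation Φ hΦ h0) Φ :=
  tensorToSeries_transportedProduct Φ

theorem IsInducedBy.tensorToSeries_mul {Φ : (K⟦X⟧ ⊗[K] 𝔤.U) ≃ₗ[K⟦X⟧] 𝔤.UT ω}
    {D : GradedDeformation 𝔤.gradingU} (h : 𝔤.IsInducedBy D Φ) (z w : 𝔤.UT ω) :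
    tensorToSeries (Φ.symm (z * w)) =
      starProduct D.π (tensorToSeries (Φ.symm z)) (tensorToSeries (Φ.symm w)) := by
  rw [← tensorToSeries_bilinear (transportedProduct Φ) h, transportedProduct_apply,
    LinearEquiv.apply_symm_apply, LinearEquiv.apply_symm_apply]

end Induced

/-- Any linear order on the letters will do, since termination rests on lengths and inversion
numbers; a well-ordering is merely a source of one. -/
theorem exists_linearOrder_homogeneousBasis : ∃ κ : ∀ g, Set (𝔤.grading g),
    ∃ _ : LinearOrder (Σ g, κ g), Nonempty (𝔤.HomogeneousBasis (Σ g, κ g)) := by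
  obtain ⟨κ, hb⟩ := 𝔤.exists_homogeneousBasis
  classical exact ⟨κ, linearOrderOfSTO WellOrderingRel, hb⟩

theorem exists_inducedDeformation [CharZero K] (ω : 𝔤.Z2) :
    ∃ (Φ : (K⟦X⟧ ⊗[K] 𝔤.U) ≃ₗ[K⟦X⟧] 𝔤.UT ω) (D : GradedDeformation 𝔤.gradingU),
      𝔤.IsGradedEquiv Φ ∧ Φ (1 ⊗ₜ[K] 1) = 1 ∧ (∀ x : L, Φ (1 ⊗ₜ[K] 𝔤.ι x) = 𝔤.ιUT ω x) ∧
        𝔤.IsInducedBy D Φ := by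
  obtain ⟨κ, _, ⟨b⟩⟩ := 𝔤.exists_linearOrder_homogeneousBasis
  obtain ⟨q, hq, hs⟩ := 𝔤.exists_specialization ω
  have h := b.specialization_pbwEquiv ω hq hs
  have h0 : ∀ u v, tensorCoeff 0 ((b.pbwEquiv ω).symm
      (b.pbwEquiv ω (1 ⊗ₜ[K] u) * b.pbwEquiv ω (1 ⊗ₜ[K] v))) = u * v := fun u v => by
    rw [← h, LinearEquiv.apply_symm_apply, map_mul, h, h]
    simp
  exact ⟨b.pbwEquiv ω, inducedDeformation _ (b.isGradedEquiv_pbwEquiv ω) h0,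
    b.isGradedEquiv_pbwEquiv ω, b.pbwEquiv_one ω, b.pbwEquiv_ι ω,
    isInducedBy_inducedDeformation _ _ _⟩

/-! ### Nontriviality of the induced deformations. -/

/-- The augmentation of `U_{tω}(𝔤)` at `t = 0`. -/
theorem exists_augmentationUT (ω : 𝔤.Z2) : ∃ α : 𝔤.UT ω →+* K,
    (∀ (s : K⟦X⟧) z, α (s • z) = PowerSeries.constantCoeff s * α z) ∧
    (∀ x, α (𝔤.ιUT ω x) = 0) ∧ ∀ g ≠ 0, ∀ z ∈ 𝔤.gradingUT ω g, α z = 0 := by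
  obtain ⟨κ, ⟨b⟩⟩ := 𝔤.exists_homogeneousBasis
  obtain ⟨q, hq, hs⟩ := 𝔤.exists_specialization ω
  obtain ⟨a, ha⟩ := 𝔤.exists_augmentation
  have hsmul : ∀ (s : K⟦X⟧) z, (a : 𝔤.U →+* K).comp q (s • z) =
      PowerSeries.constantCoeff s * (a : 𝔤.U →+* K).comp q z := fun s z => by
    simp [hs]
  have hι : ∀ x, (a : 𝔤.U →+* K).comp q (𝔤.ιUT ω x) = 0 := fun x => by simp [hq, ha]
  refine ⟨(a : 𝔤.U →+* K).comp q, hsmul, hι, fun g hg z hz => ?_⟩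
  rw [gradingUT_eq b] at hz
  induction hz using Submodule.span_induction with
  | mem z hz =>
    obtain ⟨w, hw, rfl⟩ := hz
    -- The empty word has degree 0. In any other word the first letter is sent to 0.
    match w, hw with
    | [], hw => exact absurd hw.symm hg
    | i :: w, _ =>
      have e : (b.baseChange K⟦X⟧).basis i = 1 ⊗ₜ[K] b.basis i := by
        simp [HomogeneousBasis.baseChange]
      rw [HomogeneousBasis.monomial_cons, e, ιUTLinear_tmul, one_smul, map_mul, hι, zero_mul]
  | zero => exact map_zero _
  | add x y _ _ hx hy => rw [map_add, hx, hy, add_zero]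
  | smul s x _ hx => rw [hsmul, hx, mul_zero]

/-- A trivialization turns Φ⁻¹ into a ring homomorphism from `UT` to U[[t]] with first coefficients
`p0` and `p1`. Its derivation part `p1`, evaluated through a character, yields a 1-cochain with
coboundary ω. -/
theorem cohomologyClass_eq_zero_of_isTrivial {ω : 𝔤.Z2}
    {Φ : (K⟦X⟧ ⊗[K] 𝔤.U) ≃ₗ[K⟦X⟧] 𝔤.UT ω} {D : GradedDeformation 𝔤.gradingU}
    (hΦ : 𝔤.IsGradedEquiv Φ) (hD : 𝔤.IsInducedBy D Φ) (ht : D.IsTrivial) :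
    𝔤.cohomologyClass ω = 0 := by
  obtain ⟨φ, hφ0, hφ, hmul⟩ := ht
  obtain ⟨α, hαs, hαι, hα⟩ := 𝔤.exists_augmentationUT ω
  let p0 : 𝔤.UT ω → 𝔤.U := fun z => tensorCoeff 0 (Φ.symm z)
  let p1 : 𝔤.UT ω → 𝔤.U := fun z => tensorCoeff 1 (Φ.symm z) + φ 1 (tensorCoeff 0 (Φ.symm z))
  have hc0 : ∀ z, PowerSeries.coeff 0 (formalMap φ (tensorToSeries (Φ.symm z))) = p0 z := by
    intro z
    simp [formalMap, hφ0, coeff_tensorToSeries, p0, -PowerSeries.coeff_zero_eq_constantCoeff]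
  have hc1 : ∀ z, PowerSeries.coeff 1 (formalMap φ (tensorToSeries (Φ.symm z))) = p1 z := by
    intro z
    simp [formalMap, hφ0, coeff_tensorToSeries, p1, Finset.Nat.antidiagonal_succ,
      -PowerSeries.coeff_zero_eq_constantCoeff]
  have hm : ∀ z w, formalMap φ (tensorToSeries (Φ.symm (z * w))) =
      formalMap φ (tensorToSeries (Φ.symm z)) * formalMap φ (tensorToSeries (Φ.symm w)) := by
    intro z w
    rw [hD.tensorToSeries_mul, hmul]
    exact GradedDeformation.starProduct_undeformed _ _
  have hm0 : ∀ z w, p0 (z * w) = p0 z * p0 w := by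
    intro z w
    rw [← hc0, hm, PowerSeries.coeff_mul]
    simp [hc0, -PowerSeries.coeff_zero_eq_constantCoeff]
  have hm1 : ∀ z w, p1 (z * w) = p0 z * p1 w + p1 z * p0 w := by
    intro z w
    rw [← hc1, hm, PowerSeries.coeff_mul]
    simp [hc0, hc1, Finset.Nat.antidiagonal_succ, -PowerSeries.coeff_zero_eq_constantCoeff]
  have ha1 : ∀ z w, p1 (z + w) = p1 z + p1 w := by
    intro z w
    simp only [p1, map_add]
    abel
  have hs1 : ∀ (s : K⟦X⟧) z, p1 (s • z) =
      PowerSeries.coeff 0 s • p1 z + PowerSeries.coeff 1 s • p0 z := by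
    intro s z
    have h1 : Finset.HasAntidiagonal.antidiagonal 1 = {((0, 1) : ℕ × ℕ), (1, 0)} := rfl
    simp only [p0, p1, map_smul, tensorCoeff_smul, h1, Finset.Nat.antidiagonal_zero,
      Finset.sum_singleton, smul_add]
    rw [Finset.sum_pair (by simp)]
    abel
  -- Φ need not fix 1 or 𝔤, so the standard augmentation of `U` may be the wrong character.
  -- Transporting the one of `UT` gives `e` with e ∘ p0 = α, hence e(p0(x)) = 0 for x in 𝔤.
  let e : 𝔤.U → K := fun u => α (Φ (1 ⊗ₜ[K] u))
  have he : ∀ z, e (p0 z) = α z := by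
    intro z
    -- Modulo t, `z` is Φ(1 ⊗ p0 z), and `α` kills multiples of t.
    obtain ⟨y, hy⟩ := exists_eq_tmul_tensorCoeff_add (Φ.symm z)
    have := congrArg (fun x => α (Φ x)) hy
    simp only [map_add, map_smul, hαs, PowerSeries.constantCoeff_X, zero_mul, add_zero,
      LinearEquiv.apply_symm_apply] at this
    exact this.symm
  have hea : ∀ u v, e (u + v) = e u + e v := fun u v => by
    simp only [e, TensorProduct.tmul_add, map_add]
  have hes : ∀ (r : K) u, e (r • u) = r * e u := fun r u => by
    have h : (1 : K⟦X⟧) ⊗ₜ[K] (r • u) = PowerSeries.C r • ((1 : K⟦X⟧) ⊗ₜ[K] u) := by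
      rw [TensorProduct.tmul_smul, TensorProduct.smul_tmul', TensorProduct.smul_tmul',
        PowerSeries.smul_eq_C_mul, smul_eq_mul]
    simp only [e, h, map_smul, hαs, PowerSeries.constantCoeff_C]
  have hp0 : ∀ u, p0 (Φ (1 ⊗ₜ[K] u)) = u := fun u => by simp [p0]
  have hem : ∀ u v, e (u * v) = e u * e v := fun u v => by
    conv_lhs => rw [← hp0 u, ← hp0 v, ← hm0, he, map_mul]
  have hιs : ∀ (r : K) x, 𝔤.ιUT ω (r • x) = PowerSeries.C r • 𝔤.ιUT ω x := fun r x => by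
    have := 𝔤.ιUTLinear_tmul ω 1 (r • x)
    rw [one_smul, TensorProduct.tmul_smul, TensorProduct.smul_tmul', ιUTLinear_tmul,
      PowerSeries.smul_eq_C_mul, mul_one] at this
    exact this.symm
  have hιa : ∀ x y, 𝔤.ιUT ω (x + y) = 𝔤.ιUT ω x + 𝔤.ιUT ω y := fun x y => by
    have := 𝔤.ιUTLinear_tmul ω 1 (x + y)
    rw [one_smul, TensorProduct.tmul_add, map_add, ιUTLinear_tmul, ιUTLinear_tmul, one_smul,
      one_smul] at this
    exact this.symm
  let f : L →ₗ[K] K :=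
    { toFun := fun x => e (p1 (𝔤.ιUT ω x))
      map_add' := fun x y => by rw [hιa, ha1, hea]
      map_smul' := fun r x => by
        rw [hιs, hs1, hea, hes, hes, PowerSeries.coeff_zero_C,
          PowerSeries.coeff_C, if_neg one_ne_zero, zero_mul, add_zero]
        rfl }
  -- `p1` preserves degrees because Φ and φ₁ do, and `e` vanishes outside degree 0 because `α` does.
  have hf : f ∈ 𝔤.C1 := by
    intro g x hx hg
    have h := hΦ.symm_apply_mem (𝔤.ιUT_mem ω hx)
    have h1 : p1 (𝔤.ιUT ω x) ∈ 𝔤.gradingU g :=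
      add_mem (tensorCoeff_mem_of_mem_baseChange h 1)
        (hφ 1 g _ (tensorCoeff_mem_of_mem_baseChange h 0))
    exact hα g hg _ (hΦ.apply_mem h1)
  have key : ∀ g h x y, x ∈ 𝔤.grading g → y ∈ 𝔤.grading h → ω.1 x y = -f (𝔤.bracket x y) := by
    intro g h x y hx hy
    have hr := 𝔤.ιUT_relation ω hx hy
    rw [sub_eq_iff_eq_add] at hr
    have hr' := congrArg (fun z => e (p1 z)) hr
    -- By the Leibniz rule each summand contains a factor e(p0(x)) or e(p0(y)), which is zero. In
    -- the relation only the bracket and tω(x,y)·1 survive; the latter contributes ω(x,y) e(p0(1)) =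
    -- ω(x,y).
    have hz : ∀ x y, e (p1 (𝔤.ιUT ω x * 𝔤.ιUT ω y)) = 0 := fun x y => by
      rw [hm1, hea, hem, hem, he, he, hαι, hαι, zero_mul, mul_zero, add_zero]
    simp only [ha1, hea, hz, hs1, hes,
      PowerSeries.coeff_C, if_neg one_ne_zero, mul_zero, zero_mul, add_zero,
      PowerSeries.coeff_zero_X_mul, zero_add, he, map_one, mul_one,
      show PowerSeries.coeff 1 (PowerSeries.X * PowerSeries.C (ω.1 x y)) = ω.1 x y by
        rw [← zero_add 1, PowerSeries.coeff_succ_X_mul, PowerSeries.coeff_zero_C]] at hr'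
    change 0 = f (𝔤.bracket x y) + ω.1 x y at hr'
    linear_combination -hr'
  refine (Submodule.Quotient.mk_eq_zero _).2 ⟨⟨f, hf⟩, Subtype.ext ?_⟩
  -- `key` covers homogeneous arguments only; bilinearity on a homogeneous basis gives the rest.
  obtain ⟨κ, ⟨b⟩⟩ := 𝔤.exists_homogeneousBasis
  refine b.basis.ext fun i => b.basis.ext fun j => ?_
  exact (key _ _ _ _ (b.mem_grading i) (b.mem_grading j)).symm

end ColorLieAlgebra

end

theorem mainTheorem3 {G K L : Type*} [AddCommGroup G] [DecidableEq G] [Field K] [CharZero K]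
    [AddCommGroup L] [Module K L] (ε : Bicharacter G K) (𝔤 : ColorLieAlgebra ε L) :
    (∀ ω : 𝔤.Z2, 𝔤.cohomologyClass ω ≠ 0 →
      (∃ (Φ : (K⟦X⟧ ⊗[K] 𝔤.U) ≃ₗ[K⟦X⟧] 𝔤.UT ω) (D : GradedDeformation 𝔤.gradingU),
        𝔤.IsGradedEquiv Φ ∧ Φ (1 ⊗ₜ[K] 1) = 1 ∧ (∀ x : L, Φ (1 ⊗ₜ[K] 𝔤.ι x) = 𝔤.ιUT ω x) ∧
          𝔤.IsInducedBy D Φ) ∧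
      ∀ (Φ : (K⟦X⟧ ⊗[K] 𝔤.U) ≃ₗ[K⟦X⟧] 𝔤.UT ω) (D : GradedDeformation 𝔤.gradingU),
        𝔤.IsGradedEquiv Φ → 𝔤.IsInducedBy D Φ → ¬ D.IsTrivial) ∧
    (Nontrivial 𝔤.H2 → ∃ D : GradedDeformation 𝔤.gradingU, ¬ D.IsTrivial) := by
  refine ⟨fun ω hω => ⟨𝔤.exists_inducedDeformation ω, fun Φ D hΦ hD ht =>
    hω (𝔤.cohomologyClass_eq_zero_of_isTrivial hΦ hD ht)⟩, fun _ => ?_⟩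
  obtain ⟨c, hc⟩ := exists_ne (0 : 𝔤.H2)
  obtain ⟨ω, rfl⟩ := Submodule.Quotient.mk_surjective _ c
  obtain ⟨Φ, D, hΦ, -, -, hD⟩ := 𝔤.exists_inducedDeformation ω
  exact ⟨D, fun ht => hc (𝔤.cohomologyClass_eq_zero_of_isTrivial hΦ hD ht)⟩
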